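/- Let $a,q,\alpha,\beta,\delta\in\mathbb C$ with $a\ne 0,1$. For $\gamma\in\mathbb C$ put $\varepsilon=\alpha+\beta+1-\gamma-\delta$ and consider Heun's equation $$H''(z)+\Bigl(\frac{\gamma}{z}+\frac{\delta}{z-1}+\frac{\varepsilon}{z-a}\Bigr)H'(z)+\frac{\alpha\beta z-q}{z(z-1)(z-a)}H(z)=0. \qquad (1)$$ Let $\mathbb Z_{\le 0}=\{0,-1,-2,\dots\}$, $D=\mathbb C\setminus\bigl([1,\infty)\cup a[1,\infty)\bigr)$ and $D'=D\setminus(-\infty,0)$. Put $$P_m=am(\gamma-1+m),\quad Q_m=q+(m-1)\bigl[(a+1)(\gamma+m-2)+\varepsilon+a\delta\bigr],\quad R_m=-(m-2+\alpha)(m-2+\beta).$$ For $\gamma\notin\mathbb Z_{\le0}$ let $\mathrm{HeunL}(\gamma;z)=\mathrm{HeunL}(a,q,\alpha,\beta,\gamma,\delta;z)$ be the analytic continuation to $D$ of $\sum_{m\ge0}b_mz^m$, where $b_{-1}=0$, $b_0=1$ and $P_mb_m=Q_mb_{m-1}+R_mb_{m-2}$ for $m\ge1$. For $\gamma\notin\{1,2,3,\dots\}$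 let $$\mathrm{HeunS}(\gamma;z)=z^{1-\gamma}\,\mathrm{HeunL}\bigl(a,\,q-(\gamma-1)(\varepsilon+a\delta),\,\alpha-\gamma+1,\,\beta-\gamma+1,\,2-\gamma,\,\delta;\,z\bigr)\quad(z\in D'),$$ with the principal branch of the power (and value $0$ at $z=0$ when $\operatorname{Re}\gamma<1$). For an integer $n\ge 0$, take $\gamma=-n$ in $\varepsilon,P_m,Q_m$; let $c_{-1}=0$, $c_0=1$ and $P_mc_m=Q_mc_{m-1}+R_mc_{m-2}$ for $1\le m\le n$, and put $$K_n=\frac{Q_{n+1}c_n+R_{n+1}c_{n-1}}{a(n+1)},\qquad C_n=\frac{c_n\bigl[q-\gamma(\varepsilon+a\delta-a-1)\bigr]-c_{n-1}\bigl[(1+\gamma)(2-\delta-\varepsilon)+\alpha\beta\bigr]}{a(n+1)}\Big|_{\gamma=-n}.$$ Further let $s_m=0$ for $m\le n$, $s_{n+1}=1$, $P_ms_m=Q_ms_{m-1}+R_ms_{m-2}$ for $m\ge n+2$; let $c_{n+1}=0$ and, for $m\ge n+2$, $$P_mc_m=Q_mc_{m-1}+R_mc_{m-2}+C_n\bigl(a(1-\gamma-2m)s_m+[\varepsilon+a\delta+(a+1)(\gamma+2m-3)]s_{m-1}+(4-2m-\alpha-\beta)s_{m-2}\bigr)\big|_{\gamma=-n}.$$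 For $A\in\mathbb C$ and $z\in D'$ put $$L_{n,A}(z)=\sum_{m\ge0}c_mz^m+\bigl(C_n\log z+A\bigr)\sum_{m\ge n+1}s_mz^m, \qquad (2)$$ where both power series are continued analytically to $D$, $\log$ is the principal branch, and $L_{n,A}(0)=1$. Let $\rho(r)=1$ for $r\le0$, $\rho(r)=0$ for $r\ge\frac12$, and $\rho(r)=\dfrac{e^{1/(2r)+1/(2r-1)}}{1+e^{1/(2r)+1/(2r-1)}}$ for $0<r<\frac12$. The regularized local Heun function is $$\mathrm{HeunL}_{\odot}(\gamma;z)=\mathrm{HeunL}(\gamma;z)\quad\text{if } \operatorname{dist}(\gamma,\mathbb Z_{\le0})\ge\tfrac12,\ z\in D,$$ $$\mathrm{HeunL}_{\odot}(\gamma;z)=\mathrm{HeunL}(\gamma;z)-\frac{K_n}{\gamma+n}\,\rho(|\gamma+n|)\,\mathrm{HeunS}(\gamma;z)\quad\text{if } 0<|\gamma+n|<\tfrac12,\ n\in\{0,1,2,\dots\},\ z\in D',$$ and $\mathrm{HeunL}_\odot(-n;z)$ is the limit of the last expression as $\gamma\to-n$. Then these functions are well defined: for every $\gamma\notin\mathbb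 Z_{\le0}$ the series $\sum b_mz^m$ converges near $0$ and continues analytically to $D$, and $\mathrm{HeunL}(\gamma;\cdot)$ solves (1) on $D\setminus\{0\}$; for every $n\ge0$ the series $\sum c_mz^m$ and $\sum s_mz^m$ converge near $0$ and continue analytically to $D$. Moreover: 1. For every $z\in D$, the function $\gamma\mapsto\mathrm{HeunL}_\odot(\gamma;z)$ is analytic on the closed set $\{\gamma:\operatorname{dist}(\gamma,\mathbb Z_{\le0})\ge\frac12\}$ (at each of its points it is given, on the part of this set near the point, by a convergent power series). 2. For every $z\in D'$, the function $\gamma\mapsto\mathrm{HeunL}_\odot(\gamma;z)$ is $C^\infty$ (in the real sense) on the discs $|\gamma+n|<\frac12$, $n\ge0$, centres included, and across their boundaries, that is, on all of $\mathbb C$. 3. For every integer $n\ge0$ there is a constant $A\in\mathbb C$, independent of $z$, such that for all $z\in D'$ $$\lim_{\gamma\to-n}\Bigl(\mathrm{HeunL}(\gamma;z)-\frac{K_n}{\gamma+n}\mathrm{HeunS}(\gamma;z)\Bigr)=L_{n,A}(z)=\mathrm{HeunL}_\odot(-n;z).$$ Both $L_{n,A}$ and $\mathrm{HeunS}(-n;\cdot)$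 solve (1) with $\gamma=-n$ on $D'\setminus\{0\}$, and they are linearly independent. -/

import Mathlib

open scoped ContDiff Topology

noncomputable section

namespace HeunReg

/-- The set `{0, -1, -2, ...}` of non-positive integers, inside `ℂ`. -/
def nonposInts : Set ℂ := {γ | ∃ n : ℕ, γ = -(n : ℂ)}

/-- The parameter `ε`, determined by the Fuchsian relation `α + β + 1 = γ + δ + ε`. -/
def eps (α β γ δ : ℂ) : ℂ := α + β + 1 - γ - δ

/-- `f` is a holomorphic solution of Heun's equation on the open set `S` (which has to avoid the
singular points `0`, `1`, `a`). -/
def IsHeunSolutionOn (a q α β γ δ : ℂ) (S : Set ℂ) (f : ℂ → ℂ) : Prop :=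
  DifferentiableOn ℂ f S ∧
    ∀ z ∈ S, deriv (deriv f) z
      + (γ / z + δ / (z - 1) + eps α β γ δ / (z - a)) * deriv f z
      + (α * β * z - q) / (z * (z - 1) * (z - a)) * f z = 0

/-! ### Cut planes -/

/-- The plane cut along the rays from `1` to `+∞` and from `a` to infinity in the direction of `a`
(the branch points `1` and `a` are removed as well). -/
def starDomain (a : ℂ) : Set ℂ :=
  {z | ∀ t : ℝ, 1 ≤ t → z ≠ (t : ℂ) ∧ z ≠ (t : ℂ) * a}

/-- The plane with the additional cut `(-∞, 0)`. -/
def cutDomain (a : ℂ) : Set ℂ :=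
  {z | z ∈ starDomain a ∧ ∀ t : ℝ, t < 0 → z ≠ (t : ℂ)}

/-! ### Power series at the origin and their continuation -/

/-- `f` is holomorphic on the star domain and is, near `0`, the sum of the power series with
coefficients `u`. Such an `f` is unique on the star domain. -/
def IsStarContinuation (a : ℂ) (u : ℕ → ℂ) (f : ℂ → ℂ) : Prop :=
  DifferentiableOn ℂ f (starDomain a) ∧
    ∀ᶠ z in 𝓝 (0 : ℂ), HasSum (fun m : ℕ => u m * z ^ m) (f z)

open Classical in
/-- The analytic continuation of the power series `∑ u m * z ^ m` to the star domain
(and `0` if there is none). -/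
def starContinuation (a : ℂ) (u : ℕ → ℂ) : ℂ → ℂ :=
  if h : ∃ f : ℂ → ℂ, IsStarContinuation a u f then h.choose else 0

/-! ### The local Heun functions -/

def P (a γ : ℂ) (m : ℕ) : ℂ := a * m * (γ - 1 + m)

def Q (a q α β γ δ : ℂ) (m : ℕ) : ℂ :=
  q + (m - 1) * ((a + 1) * (γ + m - 2) + eps α β γ δ + a * δ)

def R (α β : ℂ) (m : ℕ) : ℂ := -((m - 2 + α) * (m - 2 + β))

/-- The coefficients `b m`: `P m * b m = Q m * b (m-1) + R m * b (m-2)`, `b (-1) = 0`, `b 0 = 1`.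
They are meaningful as long as `P` does not vanish: for all `m` if `γ` is not a non-positive
integer, and for `m ≤ n` if `γ = -n`. -/
def heunCoeff (a q α β γ δ : ℂ) : ℕ → ℂ
  | 0 => 1
  | 1 => Q a q α β γ δ 1 / P a γ 1
  | m + 2 => (Q a q α β γ δ (m + 2) * heunCoeff a q α β γ δ (m + 1)
      + R α β (m + 2) * heunCoeff a q α β γ δ m) / P a γ (m + 2)

/-- The local Heun function `HeunL(a,q,α,β,γ,δ;z)`, for `γ` not a non-positive integer. -/
def heunL (a q α β γ δ z : ℂ) : ℂ := starContinuation a (heunCoeff a q α β γ δ) z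

/-- The second local Heun function `HeunS(a,q,α,β,γ,δ;z)`, for `γ` not a positive integer
(principal branch of the power). -/
def heunS (a q α β γ δ z : ℂ) : ℂ :=
  z ^ (1 - γ) * heunL a (q - (γ - 1) * (eps α β γ δ + a * δ)) (α - γ + 1) (β - γ + 1) (2 - γ) δ z

/-! ### The logarithmic solution for `γ = -n` -/

/-- `c k` for `k ≤ n`, computed at `γ = -n`, where the index is shifted by one:
`cPrev n 0 = c (-1) = 0` and `cPrev n (k + 1) = c k`. -/
def cPrev (a q α β δ : ℂ) (n : ℕ) : ℕ → ℂ
  | 0 => 0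
  | k + 1 => heunCoeff a q α β (-(n : ℂ)) δ k

/-- The constant `C n` in front of the logarithm (`γ = -n`). -/
def logConst (a q α β δ : ℂ) (n : ℕ) : ℂ :=
  let γ : ℂ := -(n : ℂ)
  let ε : ℂ := eps α β γ δ
  (cPrev a q α β δ n (n + 1) * (q - γ * (ε + a * δ - a - 1))
    - cPrev a q α β δ n n * ((1 + γ) * (2 - δ - ε) + α * β)) / (a * (n + 1))

/-- The coefficients `s m` (`γ = -n`): `s m = 0` for `m ≤ n`, `s (n+1) = 1`, and
`P m * s m = Q m * s (m-1) + R m * s (m-2)` for `m ≥ n+2`. -/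
def sCoeff (a q α β δ : ℂ) (n : ℕ) : ℕ → ℂ
  | 0 => 0
  | 1 => if n = 0 then 1 else 0
  | m + 2 =>
    if m + 2 ≤ n then 0
    else if m + 2 = n + 1 then 1
    else (Q a q α β (-(n : ℂ)) δ (m + 2) * sCoeff a q α β δ n (m + 1)
      + R α β (m + 2) * sCoeff a q α β δ n m) / P a (-(n : ℂ)) (m + 2)

def S (a γ : ℂ) (m : ℕ) : ℂ := a * (1 - γ - 2 * m)

def T (a α β γ δ : ℂ) (m : ℕ) : ℂ := eps α β γ δ + a * δ + (a + 1) * (γ + 2 * m - 3)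

def U (α β : ℂ) (m : ℕ) : ℂ := 4 - 2 * m - α - β

/-- The coefficients `c m` (`γ = -n`): those of the Heun recurrence with `c (-1) = 0`, `c 0 = 1`
for `m ≤ n`, then `c (n+1) = 0`, and for `m ≥ n+2`
`P m * c m = Q m * c (m-1) + R m * c (m-2) + C n * (S m * s m + T m * s (m-1) + U m * s (m-2))`. -/
def cCoeff (a q α β δ : ℂ) (n : ℕ) : ℕ → ℂ
  | 0 => 1
  | 1 => if n = 0 then 0 else heunCoeff a q α β (-(n : ℂ)) δ 1
  | m + 2 =>
    if m + 2 ≤ n then heunCoeff a q α β (-(n : ℂ)) δ (m + 2)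
    else if m + 2 = n + 1 then 0
    else (Q a q α β (-(n : ℂ)) δ (m + 2) * cCoeff a q α β δ n (m + 1)
      + R α β (m + 2) * cCoeff a q α β δ n m
      + logConst a q α β δ n *
        (S a (-(n : ℂ)) (m + 2) * sCoeff a q α β δ n (m + 2)
          + T a α β (-(n : ℂ)) δ (m + 2) * sCoeff a q α β δ n (m + 1)
          + U α β (m + 2) * sCoeff a q α β δ n m)) / P a (-(n : ℂ)) (m + 2)

/-- The logarithmic solution for `γ = -n` with free constant `A`:
`∑ c m * z ^ m + (C n * log z + A) * ∑ s m * z ^ m`, continued analytically. -/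
def heunLLog (a q α β δ : ℂ) (n : ℕ) (A z : ℂ) : ℂ :=
  starContinuation a (cCoeff a q α β δ n) z
    + (logConst a q α β δ n * Complex.log z + A) * starContinuation a (sCoeff a q α β δ n) z

/-! ### The regularization -/

/-- The constant `K n = (Q (n+1) * c n + R (n+1) * c (n-1)) / (a * (n+1))`, at `γ = -n`. -/
def K (a q α β δ : ℂ) (n : ℕ) : ℂ :=
  (Q a q α β (-(n : ℂ)) δ (n + 1) * cPrev a q α β δ n (n + 1)
    + R α β (n + 1) * cPrev a q α β δ n n) / (a * (n + 1))

/-- The cut-off function. -/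
def rho (r : ℝ) : ℝ :=
  if r ≤ 0 then 1
  else if r < 1 / 2 then
    Real.exp (1 / (2 * r) + 1 / (2 * r - 1)) / (1 + Real.exp (1 / (2 * r) + 1 / (2 * r - 1)))
  else 0

/-- The combination `HeunL - K n / (γ + n) * HeunS`, for `γ ≠ -n` close to `-n`. -/
def heunComb (a q α β δ : ℂ) (n : ℕ) (γ z : ℂ) : ℂ :=
  heunL a q α β γ δ z - K a q α β δ n / (γ + n) * heunS a q α β γ δ z

/-- The combination with the cut-off:
`HeunL - K n / (γ + n) * ρ(|γ + n|) * HeunS`, for `γ ≠ -n` close to `-n`. -/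
def heunCutComb (a q α β δ : ℂ) (n : ℕ) (γ z : ℂ) : ℂ :=
  heunL a q α β γ δ z
    - K a q α β δ n / (γ + n) * (rho ‖γ + n‖ : ℂ) * heunS a q α β γ δ z

open Classical in
/-- The regularized local Heun function. At `γ = -n`, where the defining formula
is singular, its value is the limit of the formula. -/
def heunLReg (a q α β γ δ z : ℂ) : ℂ :=
  if h : ∃ n : ℕ, ‖γ + n‖ < 1 / 2 then
    if γ = -(h.choose : ℂ) then
      Filter.limUnder (𝓝[≠] γ) (fun γ' : ℂ => heunCutComb a q α β δ h.choose γ' z)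
    else heunCutComb a q α β δ h.choose γ z
  else heunL a q α β γ δ z

end HeunReg

end

/-!
Heun's equation is written with the Euler operator `θ = z d/dz` as
`θ (θ + γ - 1) H = -G θ H - F H`, where `G` and `F` are holomorphic on the star domain and vanish
at the origin. For a solution `H = ∑ m ≤ k, u m z ^ m + z ^ (k + 1) W`, this becomes, along the ray
from `0` to `z`, an integral equation `v + J (C v) = r` for `v = (θ + k + 1) W` in the Banach
algebra `C([0, 1])`. Here `J` is the inverse of `t d/dt + k + 1`, an averaging operator of norm at
most `1 / (k + 1)`, and the norm of `C` is bounded independently of `k`. Hence for large `k` the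
equation is solved by a Neumann series, and the solution is jointly analytic in `z` and in all
parameters, since inversion is analytic in a Banach algebra. Near the
origin the power series itself is a solution (`hasSum_partialCont`), and solutions for different
`k` agree by the identity theorem on star-shaped sets (`partialCont_eq_of_le`). This proves
`exists_isAnalyticFamily`: every solution of the Heun recurrence which depends holomorphically on a
parameter yields functions on the star domain that are jointly analytic in the parameter and in
`z`. No condition is imposed on the exponents, so that resonant values of `γ` are allowed.

Conversely the differential equation follows from the recurrence, as the power series of the left
hand side vanishes at the origin (`logHeunOp_eq_zero`); this covers logarithmic solutions, too.

At `γ = -n` the coefficients of `(γ + n) * HeunL` are regular (`resCoeff`) and specialize to `K`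
times those of `HeunS`. Hence `HeunL - K / (γ + n) * HeunS` is a difference quotient, and its limit
is a derivative in `γ` of analytic families. The derivative of `z ^ (1 - γ)` produces the logarithm,
and the derivative of the two recurrences is the recurrence of the coefficients `c m`
(`cCoeff_eq_deriv`, `tendsto_heunComb`); this also continues `∑ c m z ^ m` to the star domain.

For the smoothness in `γ`, the singularity of `HeunL - K / (γ + n) * HeunS` is removable, and the
remaining summand contains the factor `(1 - ρ(|w|)) / w`, `w = γ + n`. The function `1 - ρ(r)` is
flat at `r = 0`, so that this factor is smooth (`contDiff_cutQuot`).
-/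

noncomputable section

namespace HeunReg

open Filter

/-! ### Power series in a Banach algebra -/

/-- The shifted sequence `0, c 0, c 1, ...`: the coefficients of `z * ∑ c m * z ^ m`. -/
def shift (c : ℕ → ℂ) : ℕ → ℂ
  | 0 => 0
  | m + 1 => c m

@[simp] lemma shift_zero (c : ℕ → ℂ) : shift c 0 = 0 := rfl

@[simp] lemma shift_succ (c : ℕ → ℂ) (m : ℕ) : shift c (m + 1) = c m := rfl

section PowerSeries

variable {A : Type*} [NormedCommRing A] [NormedAlgebra ℂ A]

lemma hasSum_shift {c : ℕ → ℂ} {Z s : A} (h : HasSum (fun m => c m • Z ^ m) s) :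
    HasSum (fun m => shift c m • Z ^ m) (Z * s) := by
  have h1 : HasSum (fun m => shift c (m + 1) • Z ^ (m + 1)) (Z * s) := by
    refine (h.mul_left Z).congr_fun ?_
    intro m
    simp only [shift_succ, pow_succ, mul_smul_comm]
    rw [mul_comm]
  have h2 := (hasSum_nat_add_iff (f := fun m => shift c m • Z ^ m) 1).1 h1
  simpa using h2

/-- The coefficients of `(Z - 1) (Z - a) y + Z ((δ (Z - a) + ε (Z - 1)) v + (α β Z - q) w)`, where
`y`, `v`, `w` have the coefficients `y m`, `v m`, `w m`. -/
def opCoeff (a q α β δ ε : ℂ) (y v w : ℕ → ℂ) (m : ℕ) : ℂ :=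
  a * y m - (a + 1) * shift y m + shift (shift y) m
    + (-(δ * a + ε) * shift v m + (δ + ε) * shift (shift v) m)
    + (-q * shift w m + α * β * shift (shift w) m)

lemma hasSum_opCoeff (a q α β δ ε : ℂ) {y v w : ℕ → ℂ} {Z sy sv sw : A}
    (hy : HasSum (fun m => y m • Z ^ m) sy) (hv : HasSum (fun m => v m • Z ^ m) sv)
    (hw : HasSum (fun m => w m • Z ^ m) sw) :
    HasSum (fun m => opCoeff a q α β δ ε y v w m • Z ^ m)
      ((Z - 1) * (Z - a • (1 : A)) * sy
        + Z * ((δ • (Z - a • (1 : A)) + ε • (Z - 1)) * sv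
          + ((α * β) • Z - q • (1 : A)) * sw)) := by
  have y1 := hasSum_shift hy
  have y2 := hasSum_shift y1
  have v1 := hasSum_shift hv
  have v2 := hasSum_shift v1
  have w1 := hasSum_shift hw
  have w2 := hasSum_shift w1
  have key := ((((hy.const_smul a).sub (y1.const_smul (a + 1))).add y2).add
    ((v1.const_smul (-(δ * a + ε))).add (v2.const_smul (δ + ε)))).add
    ((w1.const_smul (-q)).add (w2.const_smul (α * β)))
  have e : (Z - 1) * (Z - a • (1 : A)) * sy
        + Z * ((δ • (Z - a • (1 : A)) + ε • (Z - 1)) * sv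
          + ((α * β) • Z - q • (1 : A)) * sw)
      = a • sy - (a + 1) • (Z * sy) + Z * (Z * sy)
        + (-(δ * a + ε) • (Z * sv) + (δ + ε) • (Z * (Z * sv)))
        + (-q • (Z * sw) + (α * β) • (Z * (Z * sw))) := by
    simp only [Algebra.smul_def, map_add, map_neg, map_mul, map_one]
    ring
  rw [e]
  refine key.congr_fun fun m => ?_
  simp only [opCoeff, add_smul, sub_smul, mul_smul]

end PowerSeries

/-! ### The averaging operators on `C([0, 1])` -/

/-- The Banach algebra of continuous functions on the unit interval. For `z` in the star domain, a
function `f` on the star domain is recorded by its restriction `t ↦ f (t z)` to the ray from `0`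
to `z`. -/
def RayFun : Type := C(unitInterval, ℂ)

namespace RayFun

instance : NormedCommRing RayFun := inferInstanceAs (NormedCommRing C(unitInterval, ℂ))

instance : NormedAlgebra ℂ RayFun := inferInstanceAs (NormedAlgebra ℂ C(unitInterval, ℂ))

instance : CompleteSpace RayFun := inferInstanceAs (CompleteSpace C(unitInterval, ℂ))

instance : NormOneClass RayFun := inferInstanceAs (NormOneClass C(unitInterval, ℂ))

/-- Evaluation at a point of the unit interval. -/
def eval (t : unitInterval) : RayFun →ₐ[ℂ] ℂ := ContinuousMap.evalAlgHom ℂ ℂ t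

/-- Evaluation at a point of the unit interval, as a bounded functional. -/
def evalL (t : unitInterval) : RayFun →L[ℂ] ℂ := ContinuousMap.evalCLM ℂ t

lemma evalL_apply (t : unitInterval) (f : RayFun) : evalL t f = eval t f := rfl

lemma continuous_eval (f : RayFun) : Continuous fun t => eval t f :=
  ContinuousMap.continuous (f : C(unitInterval, ℂ))

lemma ext_eval {f g : RayFun} (h : ∀ t, eval t f = eval t g) : f = g :=
  ContinuousMap.ext (f := (f : C(unitInterval, ℂ))) h

lemma norm_le_iff {f : RayFun} {C : ℝ} (hC : 0 ≤ C) : ‖f‖ ≤ C ↔ ∀ t, ‖eval t f‖ ≤ C :=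
  ContinuousMap.norm_le (f : C(unitInterval, ℂ)) hC

lemma norm_eval_le (f : RayFun) (t : unitInterval) : ‖eval t f‖ ≤ ‖f‖ :=
  ContinuousMap.norm_coe_le_norm (f : C(unitInterval, ℂ)) t

lemma isUnit_of_eval_ne_zero {f : RayFun} (h : ∀ t, eval t f ≠ 0) : IsUnit f :=
  (ContinuousMap.isUnit_iff_forall_ne_zero (f : C(unitInterval, ℂ))).2 h

/-- The identity function of the unit interval, with complex values. -/
def X : RayFun := (⟨fun t => ((t : ℝ) : ℂ), by fun_prop⟩ : C(unitInterval, ℂ))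

@[simp] lemma eval_X (t : unitInterval) : eval t X = ((t : ℝ) : ℂ) := rfl

lemma norm_X_le : ‖X‖ ≤ 1 := by
  rw [norm_le_iff zero_le_one]
  intro t
  rw [eval_X, Complex.norm_real, Real.norm_of_nonneg t.2.1]
  exact t.2.2

lemma continuous_pow_mul_eval (k : ℕ) (f : RayFun) (t : ℝ) : Continuous fun s : ℝ =>
    (s : ℂ) ^ k * eval (Set.projIcc 0 1 zero_le_one (s * t)) f :=
  Continuous.mul (by fun_prop) ((continuous_eval f).comp (continuous_projIcc.comp (by fun_prop)))

/-- The function `t ↦ ∫ s in 0..1, s ^ k * f (s t)`. -/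
def avgFun (k : ℕ) (f : RayFun) : RayFun :=
  (⟨fun t => ∫ s in (0 : ℝ)..1, (s : ℂ) ^ k * eval (Set.projIcc 0 1 zero_le_one (s * t)) f, by
    apply intervalIntegral.continuous_parametric_intervalIntegral_of_continuous'
    refine Continuous.mul (by fun_prop) ((continuous_eval f).comp (continuous_projIcc.comp ?_))
    fun_prop⟩ : C(unitInterval, ℂ))

lemma eval_avgFun (k : ℕ) (f : RayFun) (t : unitInterval) : eval t (avgFun k f)
    = ∫ s in (0 : ℝ)..1, (s : ℂ) ^ k * eval (Set.projIcc 0 1 zero_le_one (s * t)) f := rfl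

lemma norm_avgFun_le (k : ℕ) (f : RayFun) : ‖avgFun k f‖ ≤ (1 / ((k : ℝ) + 1)) * ‖f‖ := by
  rw [norm_le_iff (by positivity)]
  intro t
  rw [eval_avgFun]
  have h1 : ‖∫ s in (0 : ℝ)..1, (s : ℂ) ^ k * eval (Set.projIcc 0 1 zero_le_one (s * t)) f‖
      ≤ ∫ s in (0 : ℝ)..1, s ^ k * ‖f‖ := by
    apply intervalIntegral.norm_integral_le_of_norm_le zero_le_one
    · refine Filter.Eventually.of_forall fun s hs => ?_
      rw [norm_mul, norm_pow, Complex.norm_real, Real.norm_of_nonneg hs.1.le]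
      exact mul_le_mul_of_nonneg_left (norm_eval_le f _) (pow_nonneg hs.1.le _)
    · exact Continuous.intervalIntegrable (by fun_prop) _ _
  refine h1.trans (le_of_eq ?_)
  rw [intervalIntegral.integral_mul_const, integral_pow]
  simp

/-- The bounded operator `f ↦ ∫ s in 0..1, s ^ k * f (s t)`: the inverse of `t d/dt + k + 1`. -/
def avg (k : ℕ) : RayFun →L[ℂ] RayFun :=
  LinearMap.mkContinuous
    { toFun := avgFun k
      map_add' := fun f g => by
        apply ext_eval
        intro t
        simp only [eval_avgFun, map_add, mul_add]
        exact intervalIntegral.integral_add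
          ((continuous_pow_mul_eval k f t).intervalIntegrable _ _)
          ((continuous_pow_mul_eval k g t).intervalIntegrable _ _)
      map_smul' := fun c f => by
        apply ext_eval
        intro t
        simp only [eval_avgFun, map_smul, smul_eq_mul, RingHom.id_apply]
        rw [← intervalIntegral.integral_const_mul]
        congr 1
        funext s
        ring }
    (1 / ((k : ℝ) + 1)) (norm_avgFun_le k)

lemma norm_avg_le (k : ℕ) : ‖avg k‖ ≤ 1 / ((k : ℝ) + 1) :=
  LinearMap.mkContinuous_norm_le _ (by positivity) _

lemma avg_X_pow (k m : ℕ) : avg k (X ^ m) = ((m : ℂ) + k + 1)⁻¹ • X ^ m := by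
  apply ext_eval
  intro t
  change eval t (avgFun k (X ^ m)) = _
  rw [eval_avgFun]
  have h1 : ∀ s ∈ Set.uIcc (0 : ℝ) 1,
      (s : ℂ) ^ k * eval (Set.projIcc 0 1 zero_le_one (s * t)) (X ^ m)
        = ((s ^ (k + m) : ℝ) : ℂ) * ((t : ℝ) : ℂ) ^ m := by
    intro s hs
    rw [Set.uIcc_of_le zero_le_one] at hs
    have hst : s * (t : ℝ) ∈ Set.Icc (0 : ℝ) 1 :=
      ⟨mul_nonneg hs.1 t.2.1, mul_le_one₀ hs.2 t.2.1 t.2.2⟩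
    rw [Set.projIcc_of_mem _ hst, map_pow, eval_X]
    push_cast
    ring
  rw [intervalIntegral.integral_congr h1, intervalIntegral.integral_mul_const,
    intervalIntegral.integral_ofReal, integral_pow]
  simp only [map_smul, map_pow, eval_X, smul_eq_mul]
  push_cast
  simp only [one_pow, ne_eq, Nat.add_eq_zero_iff, one_ne_zero, and_false, not_false_eq_true,
    zero_pow, sub_zero, one_div]
  rw [add_comm (k : ℂ) m]

end RayFun

/-! ### Growth of the coefficients -/

/-- The three-term Heun recurrence for the indices `m ≥ 2`. -/
def IsHeunRec (a q α β γ δ : ℂ) (u : ℕ → ℂ) : Prop :=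
  ∀ m, P a γ (m + 2) * u (m + 2) = Q a q α β γ δ (m + 2) * u (m + 1) + R α β (m + 2) * u m

/-- Solutions of the Heun recurrence grow at most geometrically, with a rate that is uniform for
parameters in a bounded set: for large `m` the factor `P` grows like `a * m ^ 2`, while `Q` and `R`
are at most of the order `m ^ 2`. -/
lemma exists_growth_rate (a δ : ℂ) (ha : a ≠ 0) (B : ℝ) : ∃ m₀ : ℕ, ∃ ρ : ℝ, 1 ≤ ρ ∧
    ∀ q α β γ : ℂ, ‖q‖ ≤ B → ‖α‖ ≤ B → ‖β‖ ≤ B → ‖γ‖ ≤ B → ∀ u : ℕ → ℂ,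
      IsHeunRec a q α β γ δ u → ∀ C : ℝ, (∀ m ≤ m₀ + 1, ‖u m‖ ≤ C) → ∀ m, ‖u m‖ ≤ C * ρ ^ m := by
  -- For `m ≥ m₀` this gives `‖γ + m + 1‖ ≥ (m + 2) / 2`.
  obtain ⟨m₀, hm₀⟩ := exists_nat_ge (2 * B + 2)
  -- For `m ≥ m₀`, both `Q` and `R` at the index `m + 2` are bounded by `c * (m + 2) ^ 2`.
  set c : ℝ := B + (‖a‖ + 1) * (B + 1) + (3 * B + 1 + ‖δ‖) + ‖a‖ * ‖δ‖ + (1 + B) * (1 + B) with hc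
  have ha' : 0 < ‖a‖ := norm_pos_iff.2 ha
  refine ⟨m₀, max 1 (4 * c / ‖a‖), le_max_left _ _, ?_⟩
  intro q α β γ hq hα hβ hγ u hu C hC
  set ρ := max 1 (4 * c / ‖a‖) with hρ
  have hρ1 : 1 ≤ ρ := le_max_left _ _
  have hB : 0 ≤ B := (norm_nonneg q).trans hq
  have hc0 : 0 ≤ c := by positivity
  have hC0 : 0 ≤ C := (norm_nonneg _).trans (hC 0 (by omega))
  have step : ∀ m, m₀ ≤ m → ‖u (m + 2)‖ ≤ ρ / 2 * (‖u (m + 1)‖ + ‖u m‖) := by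
    intro m hm
    set x : ℝ := (m : ℝ) + 2 with hx
    have hx2 : (2 : ℝ) ≤ x := by rw [hx]; linarith [Nat.cast_nonneg (α := ℝ) m]
    have hxB : 2 * B + 2 ≤ x := by
      have : (m₀ : ℝ) ≤ m := by exact_mod_cast hm
      linarith
    have hPx : ‖a‖ * x ^ 2 / 2 ≤ ‖P a γ (m + 2)‖ := by
      have e : P a γ (m + 2) = a * ((x : ℝ) : ℂ) * (γ + ((x - 1 : ℝ) : ℂ)) := by
        simp only [P, hx]; push_cast; ring
      have h1 : x / 2 ≤ ‖γ + ((x - 1 : ℝ) : ℂ)‖ := by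
        have := norm_sub_norm_le (((x - 1 : ℝ) : ℂ)) (-γ)
        rw [sub_neg_eq_add, norm_neg, Complex.norm_real, Real.norm_of_nonneg (by linarith),
          add_comm] at this
        have h2 : ‖((x - 1 : ℝ) : ℂ) + γ‖ = ‖γ + ((x - 1 : ℝ) : ℂ)‖ := by rw [add_comm]
        linarith
      rw [e, norm_mul, norm_mul, Complex.norm_real, Real.norm_of_nonneg (by linarith)]
      have := mul_le_mul_of_nonneg_left h1 (show 0 ≤ ‖a‖ * x by positivity)
      linarith
    have hQx : ‖Q a q α β γ δ (m + 2)‖ ≤ c * x ^ 2 := by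
      have e : Q a q α β γ δ (m + 2) = q + ((x - 1 : ℝ) : ℂ) *
          ((a + 1) * (γ + ((x - 2 : ℝ) : ℂ)) + (α + β + 1 - γ - δ) + a * δ) := by
        simp only [Q, hx, eps]; push_cast; ring
      rw [e]
      have h1 : ‖(a + 1) * (γ + ((x - 2 : ℝ) : ℂ)) + (α + β + 1 - γ - δ) + a * δ‖
          ≤ (‖a‖ + 1) * (B + (x - 2)) + (B + B + 1 + B + ‖δ‖) + ‖a‖ * ‖δ‖ := by
        refine (norm_add₃_le).trans ?_
        gcongr
        · refine (norm_mul_le _ _).trans ?_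
          gcongr
          · exact (norm_add_le _ _).trans (by simp)
          · refine (norm_add_le _ _).trans ?_
            rw [Complex.norm_real, Real.norm_of_nonneg (by linarith)]
            gcongr
        · refine (norm_sub_le _ _).trans ?_
          gcongr
          refine (norm_sub_le _ _).trans ?_
          gcongr
          refine (norm_add₃_le).trans ?_
          gcongr
          simp
        · exact norm_mul_le _ _
      refine (norm_add_le _ _).trans ?_
      rw [norm_mul, Complex.norm_real, Real.norm_of_nonneg (by linarith)]
      have h2 : (x - 1) * ‖(a + 1) * (γ + ((x - 2 : ℝ) : ℂ)) + (α + β + 1 - γ - δ) + a * δ‖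
          ≤ x * ((‖a‖ + 1) * ((B + 1) * x) + (B + B + 1 + B + ‖δ‖) * x + ‖a‖ * ‖δ‖ * x) := by
        refine mul_le_mul (by linarith) (h1.trans ?_) (norm_nonneg _) (by linarith)
        have : B + (x - 2) ≤ (B + 1) * x := by nlinarith
        have hx1 : 1 ≤ x := by linarith
        exact add_le_add (add_le_add (mul_le_mul_of_nonneg_left this (by positivity))
          (le_mul_of_one_le_right (by positivity) hx1))
          (le_mul_of_one_le_right (by positivity) hx1)
      have h3 : B ≤ B * x ^ 2 := le_mul_of_one_le_right hB (one_le_pow₀ (by linarith))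
      have h4 : 0 ≤ (1 + B) * (1 + B) * x ^ 2 := by positivity
      rw [hc]
      linarith
    have hRx : ‖R α β (m + 2)‖ ≤ c * x ^ 2 := by
      have e : R α β (m + 2) = -((((x - 2 : ℝ) : ℂ) + α) * (((x - 2 : ℝ) : ℂ) + β)) := by
        simp only [R, hx]; push_cast; ring
      have h1 : ∀ η : ℂ, ‖η‖ ≤ B → ‖((x - 2 : ℝ) : ℂ) + η‖ ≤ (1 + B) * x := by
        intro η hη
        refine (norm_add_le _ _).trans ?_
        rw [Complex.norm_real, Real.norm_of_nonneg (by linarith)]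
        nlinarith
      rw [e, norm_neg, norm_mul]
      refine (mul_le_mul (h1 α hα) (h1 β hβ) (norm_nonneg _) (by positivity)).trans ?_
      have h4 : (1 + B) * (1 + B) ≤ c := by
        rw [hc]
        have : 0 ≤ B + (‖a‖ + 1) * (B + 1) + (3 * B + 1 + ‖δ‖) + ‖a‖ * ‖δ‖ := by positivity
        linarith
      nlinarith [mul_le_mul_of_nonneg_right h4 (sq_nonneg x)]
    have hrec : ‖P a γ (m + 2)‖ * ‖u (m + 2)‖ ≤ c * x ^ 2 * (‖u (m + 1)‖ + ‖u m‖) := by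
      rw [← norm_mul, hu m]
      refine (norm_add_le _ _).trans ?_
      rw [norm_mul, norm_mul, mul_add]
      gcongr
    have hρ2 : 2 * c ≤ ‖a‖ * (ρ / 2) := by
      have := (div_le_iff₀ ha').1 (le_max_right 1 (4 * c / ‖a‖))
      rw [← hρ] at this
      linarith
    have hx0 : 0 < ‖a‖ * x ^ 2 / 2 := by positivity
    refine le_of_mul_le_mul_left ?_ hx0
    refine (mul_le_mul_of_nonneg_right hPx (norm_nonneg _)).trans (hrec.trans ?_)
    have h5 : 0 ≤ x ^ 2 / 2 * (‖u (m + 1)‖ + ‖u m‖) := by positivity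
    have h6 := mul_le_mul_of_nonneg_right hρ2 h5
    linarith
  intro m
  induction m using Nat.strong_induction_on with
  | _ m ih =>
    by_cases hm : m ≤ m₀ + 1
    · exact (hC m hm).trans (le_mul_of_one_le_right hC0 (one_le_pow₀ hρ1))
    · obtain ⟨k, rfl⟩ : ∃ k, m = k + 2 := ⟨m - 2, by omega⟩
      have h1 := ih (k + 1) (by omega)
      have h2 := ih k (by omega)
      refine (step k (by omega)).trans ?_
      have h3 : C * ρ ^ k ≤ C * ρ ^ (k + 1) :=
        mul_le_mul_of_nonneg_left (pow_le_pow_right₀ hρ1 (by omega)) hC0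
      calc ρ / 2 * (‖u (k + 1)‖ + ‖u k‖)
          ≤ ρ / 2 * (C * ρ ^ (k + 1) + C * ρ ^ (k + 1)) := by gcongr; linarith
        _ = C * ρ ^ (k + 2) := by ring

/-! ### The Heun equation on rays -/

open RayFun

/-- The coordinate `t ↦ t z` of the ray from `0` to `z`. -/
def rayZ (z : ℂ) : RayFun := z • X

lemma eval_rayZ (z : ℂ) (t : unitInterval) : eval t (rayZ z) = z * ((t : ℝ) : ℂ) := rfl

/-- The function `1 / ((z - 1) (z - a))` along a ray. -/
def rayInv (a z : ℂ) : RayFun := Ring.inverse ((rayZ z - 1) * (rayZ z - a • (1 : RayFun)))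

lemma isUnit_rayDenom {a z : ℂ} (ha : a ≠ 0) (hz : z ∈ starDomain a) :
    IsUnit ((rayZ z - 1) * (rayZ z - a • (1 : RayFun))) := by
  refine isUnit_of_eval_ne_zero fun t => ?_
  have h0 := t.2.1
  have h1 := t.2.2
  simp only [map_mul, map_sub, map_smul, map_one, eval_rayZ, smul_eq_mul, mul_one]
  have key : ∀ b : ℂ, b ≠ 0 → (∀ s : ℝ, 1 ≤ s → z ≠ s * b) → z * ((t : ℝ) : ℂ) - b ≠ 0 := by
    intro b hb hs h
    have ht : ((t : ℝ) : ℂ) ≠ 0 := by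
      intro h2
      rw [h2] at h
      simp [hb] at h
    have ht' : (0 : ℝ) < t := lt_of_le_of_ne h0 (by exact_mod_cast ht.symm)
    refine hs (t : ℝ)⁻¹ ((one_le_inv₀ ht').2 h1) ?_
    push_cast
    rw [← sub_eq_zero.1 h]
    field_simp
  exact mul_ne_zero (key 1 one_ne_zero fun s hs => by simpa using (hz s hs).1)
    (key a ha fun s hs => (hz s hs).2)

lemma rayInv_mul {a z : ℂ} (ha : a ≠ 0) (hz : z ∈ starDomain a) :
    rayInv a z * ((rayZ z - 1) * (rayZ z - a • (1 : RayFun))) = 1 :=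
  Ring.inverse_mul_cancel _ (isUnit_rayDenom ha hz)

/-- The coefficient of `θ H` in Heun's equation along a ray, where `θ = z d/dz` and the equation is
written as `θ (θ + γ - 1) H = - rayG * θ H - rayH * H`. -/
def rayG (a δ ε z : ℂ) : RayFun :=
  rayInv a z * (rayZ z * (δ • (rayZ z - a • (1 : RayFun)) + ε • (rayZ z - 1)))

/-- The coefficient of `H` in Heun's equation along a ray. -/
def rayH (a q α β z : ℂ) : RayFun :=
  rayInv a z * (rayZ z * ((α * β) • rayZ z - q • (1 : RayFun)))

/-- A bound for the coefficients of Heun's equation along the ray from `0` to `z`. -/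
def rayBound (a q α β γ δ z : ℂ) : ℝ :=
  ‖γ - 1‖ + ‖rayG a δ (eps α β γ δ) z‖ + ‖rayH a q α β z‖

/-- The operator `v ↦ (γ - 1) v + rayG v + rayH J v`, where `J = avg k`. -/
def rayPert (a q α β γ δ : ℂ) (k : ℕ) (z : ℂ) : RayFun →L[ℂ] RayFun :=
  (γ - 1) • (1 : RayFun →L[ℂ] RayFun)
    + ContinuousLinearMap.mul ℂ RayFun (rayG a δ (eps α β γ δ) z)
    + ContinuousLinearMap.mul ℂ RayFun (rayH a q α β z) * avg k

/-- The right-hand side of the integral equation for the remainder of order `k + 1`. -/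
def rayRhs (a α β γ : ℂ) (u : ℕ → ℂ) (k : ℕ) (z : ℂ) : RayFun :=
  avg k (rayInv a z * ((P a γ (k + 1) * u (k + 1)) • (1 : RayFun)
    + (R α β (k + 2) * u k) • rayZ z))

/-- If `∑ u m z ^ m = ∑ m ≤ k, u m z ^ m + z ^ (k + 1) W(z)`, this is the function
`(θ + k + 1) W` along the ray from `0` to `z`. It is obtained as the solution of
`v + J (rayPert v) = rayRhs`, which exists once `rayBound < k + 1`, as `‖J‖ ≤ 1 / (k + 1)`. -/
def raySol (a q α β γ δ : ℂ) (u : ℕ → ℂ) (k : ℕ) (z : ℂ) : RayFun :=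
  Ring.inverse (1 + avg k * rayPert a q α β γ δ k z) (rayRhs a α β γ u k z)

/-- The continuation of `∑ u m z ^ m` to the points with `rayBound < k + 1`. -/
def partialCont (a q α β γ δ : ℂ) (u : ℕ → ℂ) (k : ℕ) (z : ℂ) : ℂ :=
  ∑ m ∈ Finset.range (k + 1), u m * z ^ m
    + z ^ (k + 1) * evalL 1 (avg k (raySol a q α β γ δ u k z))

lemma norm_avg_mul_rayPert_lt {a q α β γ δ : ℂ} {k : ℕ} {z : ℂ}
    (h : rayBound a q α β γ δ z < k + 1) : ‖avg k * rayPert a q α β γ δ k z‖ < 1 := by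
  have hk : (0 : ℝ) < k + 1 := by positivity
  have hJ : ‖avg k‖ ≤ 1 :=
    (norm_avg_le k).trans ((div_le_one hk).2 (by linarith [Nat.cast_nonneg (α := ℝ) k]))
  have hp : ‖rayPert a q α β γ δ k z‖ ≤ rayBound a q α β γ δ z := by
    rw [rayBound, rayPert]
    refine (norm_add₃_le).trans ?_
    gcongr
    · rw [norm_smul]
      exact mul_le_of_le_one_right (norm_nonneg _) ContinuousLinearMap.norm_id_le
    · exact ContinuousLinearMap.opNorm_mul_apply_le ℂ RayFun _
    · refine (norm_mul_le _ _).trans ?_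
      exact (mul_le_of_le_one_right (norm_nonneg _) hJ).trans
        (ContinuousLinearMap.opNorm_mul_apply_le ℂ RayFun _)
  calc ‖avg k * rayPert a q α β γ δ k z‖ ≤ ‖avg k‖ * ‖rayPert a q α β γ δ k z‖ := norm_mul_le _ _
    _ ≤ 1 / (k + 1) * rayBound a q α β γ δ z := by
        gcongr
        exact norm_avg_le k
    _ < 1 / (k + 1) * (k + 1) := by gcongr
    _ = 1 := by field_simp

lemma isUnit_raySystem {a q α β γ δ : ℂ} {k : ℕ} {z : ℂ}
    (h : rayBound a q α β γ δ z < k + 1) : IsUnit (1 + avg k * rayPert a q α β γ δ k z) := by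
  have := isUnit_one_sub_of_norm_lt_one (x := -(avg k * rayPert a q α β γ δ k z))
    (by rw [norm_neg]; exact norm_avg_mul_rayPert_lt h)
  rwa [sub_neg_eq_add] at this

lemma norm_add_mul_le_geometric {u : ℕ → ℂ} {C ρ : ℝ} (b : ℂ) (hC : ∀ m, ‖u m‖ ≤ C * ρ ^ m)
    (m : ℕ) : ‖((m : ℂ) + b) * u m‖ ≤ C * (1 + ‖b‖) * (2 * ρ) ^ m := by
  have h1 : ‖(m : ℂ) + b‖ ≤ (1 + ‖b‖) * 2 ^ m := by
    refine (norm_add_le _ _).trans ?_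
    have h2 : (m : ℝ) ≤ 2 ^ m := by exact_mod_cast Nat.lt_two_pow_self.le
    have h3 : (1 : ℝ) ≤ 2 ^ m := one_le_pow₀ (by norm_num)
    rw [Complex.norm_natCast, add_mul, one_mul]
    exact add_le_add h2 (le_mul_of_one_le_right (norm_nonneg b) h3)
  rw [norm_mul]
  calc ‖(m : ℂ) + b‖ * ‖u m‖ ≤ (1 + ‖b‖) * 2 ^ m * (C * ρ ^ m) :=
        mul_le_mul h1 (hC m) (norm_nonneg _) (by positivity)
    _ = C * (1 + ‖b‖) * (2 * ρ) ^ m := by rw [mul_pow]; ring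

lemma exists_hasSum_rayZ {c : ℕ → ℂ} {C r : ℝ} (hr : 0 ≤ r) (hC : ∀ m, ‖c m‖ ≤ C * r ^ m) {z : ℂ}
    (hz : r * ‖z‖ < 1) : ∃ s, HasSum (fun m => c m • rayZ z ^ m) s := by
  have : Summable (fun m => c m • rayZ z ^ m) := by
    refine Summable.of_norm_bounded (g := fun m => C * (r * ‖z‖) ^ m)
      ((summable_geometric_of_lt_one (by positivity) hz).mul_left C) ?_
    intro m
    have hZ : ‖rayZ z‖ ≤ ‖z‖ := by
      rw [rayZ, norm_smul]
      exact mul_le_of_le_one_right (norm_nonneg _) norm_X_le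
    rw [norm_smul, mul_pow, ← mul_assoc]
    refine mul_le_mul (hC m) ?_ (norm_nonneg _) ((norm_nonneg _).trans (hC m))
    exact (norm_pow_le _ _).trans (pow_le_pow_left₀ (norm_nonneg _) hZ m)
  exact ⟨_, this.hasSum⟩

lemma avg_rayZ_pow (k m : ℕ) (z : ℂ) : avg k (rayZ z ^ m) = ((m : ℂ) + k + 1)⁻¹ • rayZ z ^ m := by
  simp only [rayZ, smul_pow, map_smul, avg_X_pow]
  rw [smul_comm]

/-- Near the origin the integral equation is solved by the power series itself. -/
lemma hasSum_partialCont {a q α β γ δ : ℂ} (ha : a ≠ 0) {u : ℕ → ℂ}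
    (hu : IsHeunRec a q α β γ δ u) {C ρ : ℝ} (hρ : 0 ≤ ρ) (hC : ∀ m, ‖u m‖ ≤ C * ρ ^ m) {k : ℕ}
    {z : ℂ} (hz : z ∈ starDomain a) (hzρ : 4 * ρ * ‖z‖ < 1)
    (hk : rayBound a q α β γ δ z < k + 1) :
    HasSum (fun m => u m * z ^ m) (partialCont a q α β γ δ u k z) := by
  set N : ℂ := (k : ℂ) + 1 with hN
  set x : ℕ → ℂ := fun m => u (m + (k + 1)) with hx
  have hxC : ∀ m, ‖x m‖ ≤ C * ρ ^ (k + 1) * ρ ^ m := fun m =>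
    (hC _).trans (le_of_eq (by rw [pow_add]; ring))
  have hxC1 := norm_add_mul_le_geometric N hxC
  have hxC2 := norm_add_mul_le_geometric (N + (γ - 1)) hxC1
  -- With `W = ∑ x m z ^ m` and `N = k + 1`, along the ray `s0` is `W`, `s1` is `(θ + N) W`, and
  -- `s2` is `(θ + N) (θ + N + γ - 1) W`.
  obtain ⟨s0, h0⟩ := exists_hasSum_rayZ hρ hxC (z := z) (by nlinarith [norm_nonneg z])
  obtain ⟨s1, h1⟩ := exists_hasSum_rayZ (by positivity) hxC1 (z := z)
    (by nlinarith [norm_nonneg z, mul_nonneg hρ (norm_nonneg z)])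
  obtain ⟨s2, h2⟩ := exists_hasSum_rayZ (by positivity) hxC2 (z := z)
    (by nlinarith [norm_nonneg z, mul_nonneg hρ (norm_nonneg z)])
  have hne : ∀ m : ℕ, (m : ℂ) + k + 1 ≠ 0 := fun m => by exact_mod_cast Nat.succ_ne_zero (m + k)
  have hJ1 : avg k s1 = s0 := by
    refine ((avg k).hasSum h1).unique (h0.congr_fun fun m => ?_)
    have := hne m
    simp only [map_smul, avg_rayZ_pow, smul_smul, hN]
    congr 1
    field_simp
    ring
  have hJ2 : avg k s2 = s1 + (γ - 1) • s0 := by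
    have h3 := HasSum.add h1 (HasSum.const_smul (γ - 1) h0)
    have h4 := (avg k).hasSum h2
    refine h4.unique ?_
    refine h3.congr_fun fun m => ?_
    have := hne m
    rw [map_smul, avg_rayZ_pow, smul_smul, smul_smul, ← add_smul, hN]
    congr 1
    field_simp
    ring
  have hop := hasSum_opCoeff a q α β δ (eps α β γ δ) h2 h1 h0
  -- By the recurrence, only the coefficients of order `0` and `1` survive.
  have hp : HasSum (fun m => opCoeff a q α β δ (eps α β γ δ)
      (fun m => ((m : ℂ) + (N + (γ - 1))) * (((m : ℂ) + N) * x m))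
      (fun m => ((m : ℂ) + N) * x m) x m • rayZ z ^ m)
      ((P a γ (k + 1) * u (k + 1)) • (1 : RayFun) + (R α β (k + 2) * u k) • rayZ z) := by
    have h3 := hasSum_sum_of_ne_finset_zero (L := .unconditional ℕ) (s := Finset.range 2)
      (f := fun m => opCoeff a q α β δ (eps α β γ δ)
      (fun m => ((m : ℂ) + (N + (γ - 1))) * (((m : ℂ) + N) * x m))
      (fun m => ((m : ℂ) + N) * x m) x m • rayZ z ^ m) (by
        intro m hm
        obtain ⟨j, rfl⟩ : ∃ j, m = j + 2 := ⟨m - 2, by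
          simp only [Finset.mem_range] at hm; omega⟩
        have hr := hu (j + k + 1)
        have e : opCoeff a q α β δ (eps α β γ δ)
            (fun m => ((m : ℂ) + (N + (γ - 1))) * (((m : ℂ) + N) * x m))
            (fun m => ((m : ℂ) + N) * x m) x (j + 2) = 0 := by
          simp only [opCoeff, shift_succ, hx, hN]
          simp only [P, Q, R, eps] at hr ⊢
          rw [show j + 2 + (k + 1) = j + k + 1 + 2 by ring,
            show j + 1 + (k + 1) = j + k + 1 + 1 by ring, show j + (k + 1) = j + k + 1 by ring]
          push_cast at hr ⊢
          linear_combination hr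
        rw [e, zero_smul])
    convert h3 using 1
    rw [Finset.sum_range_succ, Finset.sum_range_one, pow_zero, pow_one]
    congr 2
    · simp only [opCoeff, shift_zero, hx, hN, P]
      push_cast
      rw [Nat.zero_add]
      ring
    · have hr := hu k
      simp only [opCoeff, shift_zero, shift_succ, hx, hN]
      simp only [P, Q, R, eps] at hr ⊢
      rw [show 1 + (k + 1) = k + 2 by ring, show 0 + (k + 1) = k + 1 by ring]
      push_cast at hr ⊢
      linear_combination -hr
  have hE := hop.unique hp
  have hsys : (1 + avg k * rayPert a q α β γ δ k z) s1 = rayRhs a α β γ u k z := by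
    have hs2 : s2 = rayInv a z * ((P a γ (k + 1) * u (k + 1)) • (1 : RayFun)
        + (R α β (k + 2) * u k) • rayZ z)
        - (rayG a δ (eps α β γ δ) z * s1 + rayH a q α β z * s0) := by
      rw [← hE, rayG, rayH]
      have := rayInv_mul ha hz
      linear_combination (-s2) * this
    have hpert : rayPert a q α β γ δ k z s1
        = (γ - 1) • s1 + rayG a δ (eps α β γ δ) z * s1 + rayH a q α β z * s0 := by
      simp [rayPert, hJ1]
    have : avg k ((γ - 1) • s1) = (γ - 1) • s0 := by rw [map_smul, hJ1]
    rw [add_apply, mul_apply_eq_comp, hpert, rayRhs,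
      one_apply_eq_self, ← sub_eq_zero]
    have e : s1 = avg k s2 - (γ - 1) • s0 := by rw [hJ2]; abel
    have e2 : avg k (rayInv a z * ((P a γ (k + 1) * u (k + 1)) • (1 : RayFun)
        + (R α β (k + 2) * u k) • rayZ z)) = avg k s2
          + avg k (rayG a δ (eps α β γ δ) z * s1 + rayH a q α β z * s0) := by
      rw [← map_add, hs2]; congr 1; abel
    rw [e2, hJ2, add_assoc ((γ - 1) • s1), map_add, this]
    abel
  have hsol : raySol a q α β γ δ u k z = s1 := by
    rw [raySol, ← hsys, ← mul_apply_eq_comp,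
      Ring.inverse_mul_cancel _ (isUnit_raySystem hk), one_apply_eq_self]
  have hev : HasSum (fun m => x m * z ^ m)
      (evalL 1 (avg k (raySol a q α β γ δ u k z))) := by
    rw [hsol, hJ1]
    refine ((evalL 1).hasSum h0).congr_fun fun m => ?_
    simp [evalL_apply, eval_rayZ]
  rw [partialCont, add_comm]
  refine (hasSum_nat_add_iff (f := fun m => u m * z ^ m) (k + 1)).1 ?_
  refine (hev.mul_left (z ^ (k + 1))).congr_fun fun m => ?_
  simp only [hx]
  rw [pow_add]
  ring

/-! ### The star domain -/

lemma isOpen_starDomain (a : ℂ) : IsOpen (starDomain a) := by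
  have h : starDomain a
      = ((fun t : ℝ => t • (1 : ℂ)) '' Set.Ici 1 ∪ (fun t : ℝ => t • a) '' Set.Ici 1)ᶜ := by
    ext z
    simp only [starDomain, Set.mem_ofPred_eq, Set.mem_compl_iff, Set.mem_union, Set.mem_image,
      Set.mem_Ici, Complex.real_smul, mul_one, not_or, not_exists, not_and]
    exact ⟨fun h => ⟨fun t ht e => (h t ht).1 e.symm, fun t ht e => (h t ht).2 e.symm⟩,
      fun h t ht => ⟨fun e => h.1 t ht e.symm, fun e => h.2 t ht e.symm⟩⟩
  rw [h, isOpen_compl_iff]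
  exact (isClosedMap_smul_left (𝕜 := ℝ) (1 : ℂ) _ isClosed_Ici).union
    (isClosedMap_smul_left (𝕜 := ℝ) a _ isClosed_Ici)

lemma zero_mem_starDomain {a : ℂ} (ha : a ≠ 0) : (0 : ℂ) ∈ starDomain a := by
  intro t ht
  have : (t : ℂ) ≠ 0 := by
    have : t ≠ 0 := by linarith
    exact_mod_cast this
  exact ⟨this.symm, (mul_ne_zero this ha).symm⟩

lemma ne_one_of_mem_starDomain {a z : ℂ} (hz : z ∈ starDomain a) : z - 1 ≠ 0 :=
  sub_ne_zero.2 (by simpa using (hz 1 le_rfl).1)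

lemma ne_of_mem_starDomain {a z : ℂ} (hz : z ∈ starDomain a) : z - a ≠ 0 :=
  sub_ne_zero.2 (by simpa using (hz 1 le_rfl).2)

lemma mul_mem_starDomain {a z : ℂ} (ha : a ≠ 0) (hz : z ∈ starDomain a) {t : ℝ} (h0 : 0 ≤ t)
    (h1 : t ≤ 1) : (t : ℂ) * z ∈ starDomain a := by
  rcases h0.eq_or_lt with rfl | ht
  · simpa using zero_mem_starDomain ha
  have htc : (t : ℂ) ≠ 0 := by exact_mod_cast ht.ne'
  intro s hs
  have h2 : 1 ≤ s / t := (one_le_div ht).2 (h1.trans hs)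
  have h3 := hz (s / t) h2
  push_cast at h3
  constructor
  · intro h
    apply h3.1
    rw [← h]
    field_simp
  · intro h
    apply h3.2
    rw [div_mul_eq_mul_div, ← h]
    field_simp

lemma starConvex_starDomain {a : ℂ} (ha : a ≠ 0) : StarConvex ℝ 0 (starDomain a) :=
  starConvex_zero_iff.2 fun z hz t h0 h1 => by
    rw [Complex.real_smul]
    exact mul_mem_starDomain ha hz h0 h1

lemma isPreconnected_starDomain {a : ℂ} (ha : a ≠ 0) : IsPreconnected (starDomain a) :=
  ((starConvex_starDomain ha).isPathConnected (zero_mem_starDomain ha)).isConnected.isPreconnected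

/-! ### Monotonicity along rays -/

lemma eval_rayInv {a z : ℂ} (ha : a ≠ 0) (hz : z ∈ starDomain a) (s : unitInterval) :
    eval s (rayInv a z) = ((z * s - 1) * (z * s - a))⁻¹ := by
  apply eq_inv_of_mul_eq_one_left
  have h := congrArg (eval s) (rayInv_mul ha hz)
  simpa [eval_rayZ] using h

lemma norm_le_of_eval_mul {f g : RayFun} {t : unitInterval}
    (h : ∀ s : unitInterval, eval s f = eval (t * s) g) : ‖f‖ ≤ ‖g‖ := by
  rw [norm_le_iff (norm_nonneg g)]
  intro s
  rw [h s]
  exact norm_eval_le _ _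

/-- On a shorter ray the coefficients of the equation are restrictions of those on the longer ray,
so that their sup norms decrease towards the origin. -/
lemma rayBound_mul_le {a z : ℂ} (q α β γ δ : ℂ) (ha : a ≠ 0) (hz : z ∈ starDomain a)
    (t : unitInterval) : rayBound a q α β γ δ ((t : ℝ) * z) ≤ rayBound a q α β γ δ z := by
  have htz := mul_mem_starDomain ha hz t.2.1 t.2.2
  have e : ∀ s : unitInterval, ((t : ℝ) : ℂ) * z * ((s : ℝ) : ℂ)
      = z * (((t * s : unitInterval) : ℝ) : ℂ) := by
    intro s
    push_cast
    ring
  unfold rayBound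
  gcongr ‖γ - 1‖ + ?_ + ?_
  · refine norm_le_of_eval_mul (t := t) fun s => ?_
    simp only [rayG, map_mul, map_add, map_sub, map_smul, map_one, eval_rayZ, eval_rayInv ha hz,
      eval_rayInv ha htz, e]
  · refine norm_le_of_eval_mul (t := t) fun s => ?_
    simp only [rayH, map_mul, map_sub, map_smul, map_one, eval_rayZ, eval_rayInv ha hz,
      eval_rayInv ha htz, e]

/-! ### Analytic dependence on the parameters -/

section Analytic

variable {E : Type*} [NormedAddCommGroup E] [NormedSpace ℂ E]

@[fun_prop]
lemma analyticAt_rayZ {z : E → ℂ} {p : E} (hz : AnalyticAt ℂ z p) :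
    AnalyticAt ℂ (fun x => rayZ (z x)) p := by
  unfold rayZ
  fun_prop

lemma analyticAt_rayInv {a : ℂ} (ha : a ≠ 0) {z : E → ℂ} {p : E} (hz : AnalyticAt ℂ z p)
    (hp : z p ∈ starDomain a) : AnalyticAt ℂ (fun x => rayInv a (z x)) p := by
  obtain ⟨U, hU⟩ := isUnit_rayDenom ha hp
  have h1 : AnalyticAt ℂ (Ring.inverse : RayFun → RayFun)
      ((rayZ (z p) - 1) * (rayZ (z p) - a • (1 : RayFun))) := hU ▸ analyticAt_inverse U
  exact h1.comp (f := fun x => (rayZ (z x) - 1) * (rayZ (z x) - a • (1 : RayFun)))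
    (by fun_prop)

lemma analyticAt_rayG {a : ℂ} (ha : a ≠ 0) (δ : ℂ) {ε z : E → ℂ} {p : E} (hε : AnalyticAt ℂ ε p)
    (hz : AnalyticAt ℂ z p) (hp : z p ∈ starDomain a) :
    AnalyticAt ℂ (fun x => rayG a δ (ε x) (z x)) p := by
  have := analyticAt_rayInv ha hz hp
  unfold rayG
  fun_prop

lemma analyticAt_rayH {a : ℂ} (ha : a ≠ 0) {q α β z : E → ℂ} {p : E} (hq : AnalyticAt ℂ q p)
    (hα : AnalyticAt ℂ α p) (hβ : AnalyticAt ℂ β p)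
    (hz : AnalyticAt ℂ z p) (hp : z p ∈ starDomain a) :
    AnalyticAt ℂ (fun x => rayH a (q x) (α x) (β x) (z x)) p := by
  have := analyticAt_rayInv ha hz hp
  unfold rayH
  fun_prop

variable {a δ : ℂ} {q α β γ z : E → ℂ} {p : E}

lemma analyticAt_eps (hα : AnalyticAt ℂ α p) (hβ : AnalyticAt ℂ β p)
    (hγ : AnalyticAt ℂ γ p) : AnalyticAt ℂ (fun x => eps (α x) (β x) (γ x) δ) p := by
  unfold eps
  fun_prop

lemma continuousAt_rayBound (ha : a ≠ 0) (hq : AnalyticAt ℂ q p)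
    (hα : AnalyticAt ℂ α p) (hβ : AnalyticAt ℂ β p) (hγ : AnalyticAt ℂ γ p)
    (hz : AnalyticAt ℂ z p) (hp : z p ∈ starDomain a) :
    ContinuousAt (fun x => rayBound a (q x) (α x) (β x) (γ x) δ (z x)) p := by
  have h1 := (analyticAt_rayG ha δ (analyticAt_eps (δ := δ) hα hβ hγ) hz hp).continuousAt
  have h2 := (analyticAt_rayH ha hq hα hβ hz hp).continuousAt
  have h3 := hγ.continuousAt
  unfold rayBound
  fun_prop

lemma analyticAt_partialCont (ha : a ≠ 0) (hq : AnalyticAt ℂ q p)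
    (hα : AnalyticAt ℂ α p) (hβ : AnalyticAt ℂ β p) (hγ : AnalyticAt ℂ γ p)
    {u : E → ℕ → ℂ} (hu : ∀ m, AnalyticAt ℂ (fun x => u x m) p)
    (hz : AnalyticAt ℂ z p) (hp : z p ∈ starDomain a) {k : ℕ}
    (hk : rayBound a (q p) (α p) (β p) (γ p) δ (z p) < k + 1) :
    AnalyticAt ℂ (fun x => partialCont a (q x) (α x) (β x) (γ x) δ (u x) k (z x)) p := by
  have h0 := analyticAt_rayInv ha hz hp
  have h1 := analyticAt_rayG ha δ (analyticAt_eps (δ := δ) hα hβ hγ) hz hp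
  have h2 := analyticAt_rayH ha hq hα hβ hz hp
  have hmul : ∀ f : E → RayFun, AnalyticAt ℂ f p →
      AnalyticAt ℂ (fun x => ContinuousLinearMap.mul ℂ RayFun (f x)) p := fun f hf =>
    ((ContinuousLinearMap.mul ℂ RayFun).analyticAt _).comp hf
  have hop : AnalyticAt ℂ
      (fun x => 1 + avg k * rayPert a (q x) (α x) (β x) (γ x) δ k (z x)) p := by
    have h3 := hmul _ h1
    have h4 := hmul _ h2
    unfold rayPert
    fun_prop
  have hinv : AnalyticAt ℂ
      (fun x => Ring.inverse (1 + avg k * rayPert a (q x) (α x) (β x) (γ x) δ k (z x))) p := by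
    obtain ⟨U, hU⟩ := isUnit_raySystem hk
    have h5 : AnalyticAt ℂ (Ring.inverse : (RayFun →L[ℂ] RayFun) → (RayFun →L[ℂ] RayFun))
        (1 + avg k * rayPert a (q p) (α p) (β p) (γ p) δ k (z p)) := hU ▸ analyticAt_inverse U
    exact h5.comp
      (f := fun x => 1 + avg k * rayPert a (q x) (α x) (β x) (γ x) δ k (z x)) hop
  have hrhs : AnalyticAt ℂ (fun x => rayRhs a (α x) (β x) (γ x) (u x) k (z x)) p := by
    have h6 := hu (k + 1)
    have h7 := hu k
    unfold rayRhs P R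
    refine ((avg k).analyticAt _).comp ?_
    fun_prop
  have hsol : AnalyticAt ℂ (fun x => raySol a (q x) (α x) (β x) (γ x) δ (u x) k (z x)) p :=
    ((ContinuousLinearMap.id ℂ (RayFun →L[ℂ] RayFun)).analyticAt_bilinear _).comp
      (hinv.prod hrhs)
  have hev : AnalyticAt ℂ
      (fun x => evalL 1 (avg k (raySol a (q x) (α x) (β x) (γ x) δ (u x) k (z x)))) p :=
    (((evalL 1).comp (avg k)).analyticAt _).comp hsol
  unfold partialCont
  refine AnalyticAt.add ?_ ?_
  · refine Finset.analyticAt_fun_sum _ fun m _ => ?_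
    have := hu m
    fun_prop
  · fun_prop

end Analytic

/-! ### Gluing the partial continuations -/

/-- The rate at which the coefficients grow is locally uniform in the parameters. -/
lemma exists_locally_uniform_growth {a δ : ℂ} (ha : a ≠ 0) {q α β γ : ℂ → ℂ} {u : ℂ → ℕ → ℂ}
    {w₀ : ℂ} (hq : ContinuousAt q w₀) (hα : ContinuousAt α w₀) (hβ : ContinuousAt β w₀)
    (hγ : ContinuousAt γ w₀) (hu : ∀ m, ContinuousAt (fun w => u w m) w₀)
    (hrec : ∀ᶠ w in 𝓝 w₀, IsHeunRec a (q w) (α w) (β w) (γ w) δ (u w)) :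
    ∃ C ρ : ℝ, 0 ≤ ρ ∧ ∀ᶠ w in 𝓝 w₀, ∀ m, ‖u w m‖ ≤ C * ρ ^ m := by
  set B := ‖q w₀‖ + ‖α w₀‖ + ‖β w₀‖ + ‖γ w₀‖ + 1 with hB
  have hnear : ∀ {f : ℂ → ℂ}, ContinuousAt f w₀ → ∀ {c : ℝ}, ‖f w₀‖ < c →
      ∀ᶠ w in 𝓝 w₀, ‖f w‖ ≤ c := fun hf c hc =>
    (hf.norm.eventually (gt_mem_nhds hc)).mono fun _ h => le_of_lt h
  obtain ⟨m₀, ρ, hρ, h⟩ := exists_growth_rate a δ ha B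
  set C := ∑ m ∈ Finset.range (m₀ + 2), (‖u w₀ m‖ + 1) with hC
  have h1 : ∀ᶠ w in 𝓝 w₀, ∀ m ∈ Finset.range (m₀ + 2), ‖u w m‖ ≤ ‖u w₀ m‖ + 1 :=
    (Finset.eventually_all _).2 fun m _ => hnear (hu m) (lt_add_one _)
  have n1 := norm_nonneg (q w₀)
  have n2 := norm_nonneg (α w₀)
  have n3 := norm_nonneg (β w₀)
  have n4 := norm_nonneg (γ w₀)
  refine ⟨C, ρ, by linarith, ?_⟩
  filter_upwards [hnear hq (c := B) (by linarith), hnear hα (c := B) (by linarith),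
    hnear hβ (c := B) (by linarith), hnear hγ (c := B) (by linarith), hrec, h1]
    with w e1 e2 e3 e4 e5 e6
  refine h _ _ _ _ e1 e2 e3 e4 _ e5 C fun m hm => ?_
  have hm' : m ∈ Finset.range (m₀ + 2) := by simp; omega
  exact (e6 m hm').trans (Finset.single_le_sum (f := fun m => ‖u w₀ m‖ + 1)
    (fun i _ => by positivity) hm')

lemma eventually_hasSum_partialCont {a q α β γ δ : ℂ} (ha : a ≠ 0) {u : ℕ → ℂ}
    (hu : IsHeunRec a q α β γ δ u) {k : ℕ} (hk : rayBound a q α β γ δ 0 < k + 1) :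
    ∀ᶠ z in 𝓝 (0 : ℂ), HasSum (fun m => u m * z ^ m) (partialCont a q α β γ δ u k z) := by
  obtain ⟨C, ρ, hρ, h⟩ := exists_locally_uniform_growth (δ := δ) (w₀ := 0) ha
    (q := fun _ => q) (α := fun _ => α) (β := fun _ => β) (γ := fun _ => γ) (u := fun _ => u)
    continuousAt_const continuousAt_const continuousAt_const continuousAt_const
    (fun _ => continuousAt_const) (Eventually.of_forall fun _ => hu)
  have hC := h.self_of_nhds
  have hb : ContinuousAt (fun z => rayBound a q α β γ δ z) 0 :=
    continuousAt_rayBound ha analyticAt_const analyticAt_const analyticAt_const analyticAt_const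
      analyticAt_id (zero_mem_starDomain ha)
  have hz : ∀ᶠ z in 𝓝 (0 : ℂ), 4 * ρ * ‖z‖ < 1 :=
    (show Continuous fun z : ℂ => 4 * ρ * ‖z‖ by fun_prop).continuousAt.eventually
      (gt_mem_nhds (by simp))
  filter_upwards [(isOpen_starDomain a).mem_nhds (zero_mem_starDomain ha), hz,
    hb.eventually (gt_mem_nhds hk)] with z h1 h2 h3
  exact hasSum_partialCont ha hu hρ hC h1 h2 h3

/-- The partial continuations of different orders agree, by the identity theorem on the
star-shaped set where the smaller order is admissible. -/
lemma partialCont_eq_of_le {a q α β γ δ : ℂ} (ha : a ≠ 0) {u : ℕ → ℂ}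
    (hu : IsHeunRec a q α β γ δ u) {k l : ℕ} (hkl : k ≤ l) {z : ℂ} (hz : z ∈ starDomain a)
    (hk : rayBound a q α β γ δ z < k + 1) :
    partialCont a q α β γ δ u k z = partialCont a q α β γ δ u l z := by
  set V : Set ℂ := {z | z ∈ starDomain a ∧ rayBound a q α β γ δ z < k + 1} with hV
  have hkl' : (k : ℝ) + 1 ≤ l + 1 := by exact_mod_cast Nat.succ_le_succ hkl
  have hstar : StarConvex ℝ 0 V := starConvex_zero_iff.2 fun x hx t h0 h1 => by
    rw [Complex.real_smul]
    exact ⟨mul_mem_starDomain ha hx.1 h0 h1,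
      (rayBound_mul_le q α β γ δ ha hx.1 ⟨t, h0, h1⟩).trans_lt hx.2⟩
  have hzV : z ∈ V := ⟨hz, hk⟩
  have h0V : (0 : ℂ) ∈ V := by
    have := starConvex_zero_iff.1 hstar hzV le_rfl zero_le_one
    simpa using this
  have han : ∀ j : ℕ, k ≤ j → AnalyticOnNhd ℂ (partialCont a q α β γ δ u j) V := by
    intro j hj x hx
    have hkj : (k : ℝ) + 1 ≤ j + 1 := by exact_mod_cast Nat.succ_le_succ hj
    exact analyticAt_partialCont (q := fun _ => q) (α := fun _ => α) (β := fun _ => β)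
      (γ := fun _ => γ) (u := fun _ => u) (z := fun x => x) ha analyticAt_const analyticAt_const
      analyticAt_const analyticAt_const (fun _ => analyticAt_const) analyticAt_id hx.1
      (hx.2.trans_le hkj)
  refine (han k le_rfl).eqOn_of_preconnected_of_eventuallyEq (han l hkl)
    (hstar.isPathConnected h0V).isConnected.isPreconnected h0V ?_ hzV
  filter_upwards [eventually_hasSum_partialCont ha hu h0V.2,
    eventually_hasSum_partialCont ha hu (h0V.2.trans_le hkl')] with x h1 h2
  exact h1.unique h2

/-- A family of functions `H w` that continues the power series `∑ u w m * z ^ m` to the star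
domain, jointly analytic in the parameter `w ∈ Γ` and in `z`; the coefficients grow at most
geometrically, locally uniformly in `w`. -/
structure IsAnalyticFamily (a : ℂ) (Γ : Set ℂ) (u : ℂ → ℕ → ℂ) (H : ℂ → ℂ → ℂ) : Prop where
  analyticAt : ∀ w ∈ Γ, ∀ z ∈ starDomain a, AnalyticAt ℂ (fun p : ℂ × ℂ => H p.1 p.2) (w, z)
  growth : ∀ w₀ ∈ Γ, ∃ C ρ : ℝ, 0 ≤ ρ ∧ ∀ᶠ w in 𝓝 w₀, ∀ m, ‖u w m‖ ≤ C * ρ ^ m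
  hasSum : ∀ w ∈ Γ, ∀ᶠ p : ℂ × ℂ in 𝓝 (w, 0), HasSum (fun m => u p.1 m * p.2 ^ m) (H p.1 p.2)

/-- The power series attached to a solution of the Heun recurrence that depends holomorphically on
a parameter continues to the star domain, jointly analytically. -/
theorem exists_isAnalyticFamily {a δ : ℂ} (ha : a ≠ 0) {Γ : Set ℂ} (hΓ : IsOpen Γ)
    {q α β γ : ℂ → ℂ} {u : ℂ → ℕ → ℂ} (hq : DifferentiableOn ℂ q Γ) (hα : DifferentiableOn ℂ α Γ)
    (hβ : DifferentiableOn ℂ β Γ) (hγ : DifferentiableOn ℂ γ Γ)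
    (hu : ∀ m, DifferentiableOn ℂ (fun w => u w m) Γ)
    (hrec : ∀ w ∈ Γ, IsHeunRec a (q w) (α w) (β w) (γ w) δ (u w)) :
    ∃ H, IsAnalyticFamily a Γ u H := by
  set M : ℂ × ℂ → ℝ := fun p => rayBound a (q p.1) (α p.1) (β p.1) (γ p.1) δ p.2 with hM
  set F : ℕ → ℂ × ℂ → ℂ := fun k p =>
    partialCont a (q p.1) (α p.1) (β p.1) (γ p.1) δ (u p.1) k p.2 with hF
  have lift : ∀ {f : ℂ → ℂ}, DifferentiableOn ℂ f Γ → ∀ {w}, w ∈ Γ → ∀ z,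
      AnalyticAt ℂ (fun p : ℂ × ℂ => f p.1) (w, z) := fun hf w hw z =>
    (hf.analyticAt (hΓ.mem_nhds hw)).fun_comp (f := fun p : ℂ × ℂ => p.1) analyticAt_fst
  have hMcont : ∀ w ∈ Γ, ∀ z ∈ starDomain a, ContinuousAt M (w, z) := fun w hw z hz =>
    continuousAt_rayBound ha (lift hq hw z) (lift hα hw z) (lift hβ hw z) (lift hγ hw z)
      analyticAt_snd hz
  have hlt : ∀ p, M p < ⌈M p⌉₊ + 1 := fun p => (Nat.le_ceil _).trans_lt (lt_add_one _)
  have hnhds : ∀ w ∈ Γ, ∀ z ∈ starDomain a, ∀ᶠ p : ℂ × ℂ in 𝓝 (w, z),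
      p.1 ∈ Γ ∧ p.2 ∈ starDomain a := fun w hw z hz =>
    (hΓ.prod (isOpen_starDomain a)).mem_nhds ⟨hw, hz⟩
  have heq : ∀ w ∈ Γ, ∀ z ∈ starDomain a, ∀ k : ℕ, M (w, z) < k + 1 →
      ∀ᶠ p in 𝓝 (w, z), F ⌈M p⌉₊ p = F k p := by
    intro w hw z hz k hk
    filter_upwards [hnhds w hw z hz, (hMcont w hw z hz).eventually (gt_mem_nhds hk)] with p hp1 hp2
    rcases le_total ⌈M p⌉₊ k with h | h
    · exact partialCont_eq_of_le ha (hrec p.1 hp1.1) h hp1.2 (hlt p)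
    · exact (partialCont_eq_of_le ha (hrec p.1 hp1.1) h hp1.2 hp2).symm
  have hgrowth : ∀ w₀ ∈ Γ, ∃ C ρ : ℝ, 0 ≤ ρ ∧ ∀ᶠ w in 𝓝 w₀, ∀ m, ‖u w m‖ ≤ C * ρ ^ m := by
    intro w hw
    have hn := hΓ.mem_nhds hw
    exact exists_locally_uniform_growth ha (hq.continuousOn.continuousAt hn)
      (hα.continuousOn.continuousAt hn) (hβ.continuousOn.continuousAt hn)
      (hγ.continuousOn.continuousAt hn) (fun m => (hu m).continuousOn.continuousAt hn)
      (by filter_upwards [hn] with x hx using hrec x hx)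
  -- The order used at `(w, z)` varies with the point, but it may be replaced locally by a fixed one.
  refine ⟨fun w z => F ⌈M (w, z)⌉₊ (w, z), ?_, hgrowth, ?_⟩
  · intro w hw z hz
    have h1 : AnalyticAt ℂ (F ⌈M (w, z)⌉₊) (w, z) :=
      analyticAt_partialCont ha (lift hq hw z) (lift hα hw z) (lift hβ hw z) (lift hγ hw z)
        (fun m => lift (hu m) hw z) analyticAt_snd hz (hlt (w, z))
    refine h1.congr ?_
    filter_upwards [heq w hw z hz _ (hlt (w, z))] with p hp using hp.symm
  · intro w hw
    have h0 := zero_mem_starDomain ha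
    obtain ⟨C, ρ, hρ, hC⟩ := hgrowth w hw
    have hz : ∀ᶠ p : ℂ × ℂ in 𝓝 (w, 0), 4 * ρ * ‖p.2‖ < 1 :=
      (show Continuous fun p : ℂ × ℂ => 4 * ρ * ‖p.2‖ by fun_prop).continuousAt.eventually
        (gt_mem_nhds (by simp))
    filter_upwards [hnhds w hw 0 h0, continuousAt_fst.eventually hC, hz] with p hp1 hp2 hp3
    exact hasSum_partialCont ha (hrec p.1 hp1.1) hρ hp2 hp1.2 hp3 (hlt p)

/-! ### Star continuations -/

namespace IsStarContinuation

variable {a : ℂ} {u v : ℕ → ℂ} {f g : ℂ → ℂ}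

lemma analyticOnNhd (hf : IsStarContinuation a u f) : AnalyticOnNhd ℂ f (starDomain a) :=
  hf.1.analyticOnNhd (isOpen_starDomain a)

lemma eqOn (ha : a ≠ 0) (hf : IsStarContinuation a u f) (hg : IsStarContinuation a u g) :
    Set.EqOn f g (starDomain a) := by
  refine hf.analyticOnNhd.eqOn_of_preconnected_of_eventuallyEq hg.analyticOnNhd
    (isPreconnected_starDomain ha) (zero_mem_starDomain ha) ?_
  filter_upwards [hf.2, hg.2] with z h1 h2 using h1.unique h2

lemma spec (hf : IsStarContinuation a u f) :
    IsStarContinuation a u (starContinuation a u) := by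
  have h : ∃ f : ℂ → ℂ, IsStarContinuation a u f := ⟨f, hf⟩
  rw [starContinuation, dif_pos h]
  exact h.choose_spec

lemma starContinuation_eq (ha : a ≠ 0) (hf : IsStarContinuation a u f) {z : ℂ}
    (hz : z ∈ starDomain a) : starContinuation a u z = f z :=
  hf.spec.eqOn ha hf hz

lemma sub (hf : IsStarContinuation a u f) (hg : IsStarContinuation a v g) :
    IsStarContinuation a (fun m => u m - v m) (fun z => f z - g z) := by
  refine ⟨hf.1.sub hg.1, ?_⟩
  filter_upwards [hf.2, hg.2] with z h1 h2
  simpa only [sub_mul] using h1.sub h2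

lemma const_mul (c : ℂ) (hf : IsStarContinuation a u f) :
    IsStarContinuation a (fun m => c * u m) (fun z => c * f z) := by
  refine ⟨hf.1.const_mul c, ?_⟩
  filter_upwards [hf.2] with z h1
  simpa only [mul_assoc] using h1.mul_left c

/-- Multiplication by `z ^ k` shifts the coefficients. -/
lemma pow_mul (k : ℕ) (hf : IsStarContinuation a u f) :
    IsStarContinuation a (fun m => if k ≤ m then u (m - k) else 0) (fun z => z ^ k * f z) := by
  refine ⟨(differentiableOn_id.pow k).mul hf.1, ?_⟩
  filter_upwards [hf.2] with z h1
  rw [← hasSum_nat_add_iff' k]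
  have h2 : ∑ i ∈ Finset.range k, (if k ≤ i then u (i - k) else 0) * z ^ i = 0 := by
    refine Finset.sum_eq_zero fun i hi => ?_
    rw [if_neg (by simpa using hi), zero_mul]
  rw [h2, sub_zero]
  refine (h1.mul_left (z ^ k)).congr_fun fun m => ?_
  rw [if_pos (Nat.le_add_left k m), Nat.add_sub_cancel, pow_add]
  ring

lemma apply_zero (hf : IsStarContinuation a u f) : f 0 = u 0 := by
  have h1 := hf.2.self_of_nhds
  refine h1.unique ?_
  have h2 := hasSum_single (f := fun m => u m * (0 : ℂ) ^ m) 0 fun m hm => by simp [hm]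
  simpa using h2

lemma congr_coeff (hf : IsStarContinuation a u f) (h : ∀ m, v m = u m) :
    IsStarContinuation a v f := by
  rwa [funext h]

lemma congr_fun (hf : IsStarContinuation a u f) (h : Set.EqOn g f (starDomain a)) (ha : a ≠ 0) :
    IsStarContinuation a u g := by
  refine ⟨hf.1.congr h, ?_⟩
  filter_upwards [hf.2, (isOpen_starDomain a).mem_nhds (zero_mem_starDomain ha)] with z h1 h2
  rwa [h h2]

end IsStarContinuation

namespace IsAnalyticFamily

variable {a : ℂ} {Γ : Set ℂ} {u : ℂ → ℕ → ℂ} {H : ℂ → ℂ → ℂ}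

lemma analyticAt_right (h : IsAnalyticFamily a Γ u H) {w z : ℂ} (hw : w ∈ Γ)
    (hz : z ∈ starDomain a) : AnalyticAt ℂ (H w) z :=
  (h.analyticAt w hw z hz).fun_comp (f := fun z => (w, z)) (analyticAt_const.prod analyticAt_id)

lemma analyticAt_left (h : IsAnalyticFamily a Γ u H) {w z : ℂ} (hw : w ∈ Γ)
    (hz : z ∈ starDomain a) : AnalyticAt ℂ (fun w => H w z) w :=
  (h.analyticAt w hw z hz).fun_comp (f := fun w => (w, z)) (analyticAt_id.prod analyticAt_const)

lemma isStarContinuation (h : IsAnalyticFamily a Γ u H) {w : ℂ} (hw : w ∈ Γ) :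
    IsStarContinuation a (u w) (H w) := by
  refine ⟨fun z hz => (h.analyticAt_right hw hz).differentiableAt.differentiableWithinAt, ?_⟩
  exact (show Continuous fun z : ℂ => (w, z) by fun_prop).continuousAt.eventually (h.hasSum w hw)

/-- The derivative of an analytic family in the parameter continues the power series whose
coefficients are the derivatives of the coefficients. -/
lemma isStarContinuation_deriv (h : IsAnalyticFamily a Γ u H) (hΓ : IsOpen Γ)
    (hu : ∀ m, DifferentiableOn ℂ (fun w => u w m) Γ) {w₀ : ℂ} (hw : w₀ ∈ Γ) :
    IsStarContinuation a (fun m => deriv (fun w => u w m) w₀)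
      (fun z => deriv (fun w => H w z) w₀) := by
  constructor
  · have h1 : ∀ z ∈ starDomain a, deriv (fun w => H w z) w₀
        = fderiv ℂ (fun p : ℂ × ℂ => H p.1 p.2) (w₀, z) (1, 0) := by
      intro z hz
      have h2 := (h.analyticAt w₀ hw z hz).differentiableAt.hasFDerivAt
      have h3 : HasDerivAt (fun w : ℂ => (w, z)) (1, 0) w₀ :=
        (hasDerivAt_id w₀).prodMk (hasDerivAt_const w₀ z)
      exact (h2.comp_hasDerivAt w₀ h3).deriv
    refine DifferentiableOn.congr (fun z hz => ?_) h1
    have h4 : AnalyticAt ℂ (fun z => fderiv ℂ (fun p : ℂ × ℂ => H p.1 p.2) (w₀, z)) z :=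
      (h.analyticAt w₀ hw z hz).fderiv.fun_comp (f := fun z => (w₀, z))
        (analyticAt_const.prod analyticAt_id)
    exact (h4.differentiableAt.clm_apply
      (differentiableAt_const ((1 : ℂ), (0 : ℂ)))).differentiableWithinAt
  · -- Termwise differentiation in `w`, by the locally uniform growth of the coefficients.
    obtain ⟨C, ρ, hρ, hC⟩ := h.growth w₀ hw
    obtain ⟨U, hU, V, hV, hUV⟩ := mem_nhds_prod_iff.1 (h.hasSum w₀ hw)
    obtain ⟨r, hr, hball⟩ := Metric.mem_nhds_iff.1
      (inter_mem (inter_mem hU hC) (hΓ.mem_nhds hw))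
    have hz : ∀ᶠ z in 𝓝 (0 : ℂ), ρ * ‖z‖ < 1 :=
      (show Continuous fun z : ℂ => ρ * ‖z‖ by fun_prop).continuousAt.eventually
        (gt_mem_nhds (by simp))
    filter_upwards [hV, hz] with z hzV hzρ
    have hsum : Summable fun m => C * (ρ * ‖z‖) ^ m :=
      (summable_geometric_of_lt_one (by positivity) hzρ).mul_left C
    have hd : ∀ m, DifferentiableOn ℂ (fun w => u w m * z ^ m) (Metric.ball w₀ r) := fun m =>
      ((hu m).mono fun w hw => (hball hw).2).mul_const _
    have h5 := Complex.hasSum_deriv_of_summable_norm hsum hd Metric.isOpen_ball (by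
      intro m w hw
      rw [norm_mul, norm_pow, mul_pow, ← mul_assoc]
      exact mul_le_mul_of_nonneg_right ((hball hw).1.2 m) (by positivity))
      (Metric.mem_ball_self hr)
    have h6 : (fun w => ∑' m, u w m * z ^ m) =ᶠ[𝓝 w₀] fun w => H w z := by
      filter_upwards [Metric.ball_mem_nhds w₀ hr] with w hw
      exact (hUV (Set.mk_mem_prod (hball hw).1.1 hzV)).tsum_eq
    rw [h6.deriv_eq] at h5
    refine h5.congr_fun fun m => ?_
    exact (deriv_mul_const ((hu m).differentiableAt (hΓ.mem_nhds hw)) _).symm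

end IsAnalyticFamily

/-! ### From the recurrence to the differential equation -/

/-- Termwise application of the Euler operator `z d/dz`. -/
lemma hasSum_theta {u : ℕ → ℂ} {f : ℂ → ℂ}
    (h : ∀ᶠ z in 𝓝 (0 : ℂ), HasSum (fun m => u m * z ^ m) (f z)) :
    ∀ᶠ z in 𝓝 (0 : ℂ), HasSum (fun m : ℕ => m * u m * z ^ m) (z * deriv f z) := by
  obtain ⟨r, hr, hball⟩ := Metric.eventually_nhds_iff_ball.1 h
  have hr2 : ((r / 2 : ℝ) : ℂ) ∈ Metric.ball (0 : ℂ) r := by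
    rw [mem_ball_zero_iff, Complex.norm_real, Real.norm_of_nonneg (by positivity)]
    linarith
  obtain ⟨C, hC⟩ : ∃ C, ∀ m, ‖u m * ((r / 2 : ℝ) : ℂ) ^ m‖ ≤ C := by
    have h1 := (hball _ hr2).summable.tendsto_atTop_zero.norm.bddAbove_range
    obtain ⟨C, hC⟩ := h1
    exact ⟨C, fun m => hC ⟨m, rfl⟩⟩
  have hC' : ∀ m, ‖u m‖ * (r / 2) ^ m ≤ C := by
    intro m
    have := hC m
    rwa [norm_mul, norm_pow, Complex.norm_real, Real.norm_of_nonneg (by positivity)] at this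
  filter_upwards [Metric.ball_mem_nhds (0 : ℂ) (show 0 < r / 4 by positivity)] with z hz
  have hsum : Summable fun m : ℕ => C * (1 / 2 : ℝ) ^ m :=
    (summable_geometric_of_lt_one (by norm_num) (by norm_num)).mul_left C
  have h5 := Complex.hasSum_deriv_of_summable_norm (F := fun m w => u m * w ^ m) hsum
    (fun m => by fun_prop) (Metric.isOpen_ball (x := (0 : ℂ)) (ε := r / 4)) (by
      intro m w hw
      rw [mem_ball_zero_iff] at hw
      rw [norm_mul, norm_pow]
      have h6 : ‖w‖ ^ m ≤ (r / 2) ^ m * (1 / 2) ^ m := by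
        rw [← mul_pow]
        exact pow_le_pow_left₀ (norm_nonneg _) (by linarith) m
      calc ‖u m‖ * ‖w‖ ^ m ≤ ‖u m‖ * ((r / 2) ^ m * (1 / 2) ^ m) := by gcongr
        _ = ‖u m‖ * (r / 2) ^ m * (1 / 2) ^ m := by ring
        _ ≤ C * (1 / 2) ^ m := by gcongr; exact hC' m) hz
  have h7 : (fun w => ∑' m, u m * w ^ m) =ᶠ[𝓝 z] f := by
    filter_upwards [Metric.isOpen_ball.mem_nhds hz] with w hw
    refine (hball w ?_).tsum_eq
    rw [mem_ball_zero_iff] at hw ⊢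
    linarith
  rw [h7.deriv_eq] at h5
  refine (h5.mul_left z).congr_fun fun m => ?_
  rw [deriv_const_mul_field, deriv_pow_field]
  rcases m with _ | m
  · simp
  · rw [Nat.add_sub_cancel, pow_succ]
    ring

/-- The sequences `c`, `s` satisfy the recurrence for the coefficients of a solution of Heun's
equation of the form `∑ c m * z ^ m + k * log z * ∑ s m * z ^ m`. The second condition is the
equation for the index `0`. -/
def IsLogHeunSeq (a q α β γ δ k : ℂ) (c s : ℕ → ℂ) : Prop :=
  (P a γ 1 * c 1 = Q a q α β γ δ 1 * c 0 + k * (S a γ 1 * s 1 + T a α β γ δ 1 * s 0)) ∧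
  (S a γ 0 * s 0 = 0 ∨ k = 0) ∧
  ∀ m, P a γ (m + 2) * c (m + 2) = Q a q α β γ δ (m + 2) * c (m + 1) + R α β (m + 2) * c m
    + k * (S a γ (m + 2) * s (m + 2) + T a α β γ δ (m + 2) * s (m + 1) + U α β (m + 2) * s m)

/-- Heun's operator, multiplied by `z ^ 2 * (z - 1) * (z - a)`, applied to `f + k * log z * g`,
up to the summand that contains the logarithm. -/
def logHeunOp (a q α β γ δ k : ℂ) (f g : ℂ → ℂ) (z : ℂ) : ℂ :=
  (z - 1) * (z - a) * (z * deriv (fun x => x * deriv f x) z + (γ - 1) * (z * deriv f z)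
      + k * (2 * (z * deriv g z) + (γ - 1) * g z))
    + z * ((δ * (z - a) + eps α β γ δ * (z - 1)) * (z * deriv f z + k * g z)
      + (α * β * z - q) * f z)

lemma opCoeff_eq_zero {a q α β γ δ k : ℂ} {c s : ℕ → ℂ} (hrec : IsLogHeunSeq a q α β γ δ k c s)
    (m : ℕ) : opCoeff a q α β δ (eps α β γ δ)
      (fun m => m * (m * c m) + (γ - 1) * (m * c m) + k * (2 * (m * s m) + (γ - 1) * s m))
      (fun m => m * c m + k * s m) c m = 0 := by
  obtain ⟨hr1, hr0, hr⟩ := hrec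
  rcases m with _ | _ | m
  · simp only [opCoeff, shift_zero]
    simp only [S] at hr0
    rcases hr0 with h | h
    · push_cast at h ⊢
      have h' : a * (γ - 1) * s 0 = 0 := by linear_combination -h
      linear_combination k * h'
    · rw [h]; push_cast; ring
  · simp only [opCoeff, shift_zero, shift_succ]
    simp only [P, Q, S, T, eps] at hr1 ⊢
    push_cast at hr1 ⊢
    linear_combination hr1
  · have h := hr m
    simp only [opCoeff, shift_succ]
    simp only [P, Q, R, S, T, U, eps] at h ⊢
    push_cast at h ⊢
    linear_combination h

/-- The power series of `logHeunOp f g` at the origin vanishes by the recurrence, hence so does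
`logHeunOp f g` on the star domain. -/
lemma logHeunOp_eq_zero {a q α β γ δ k : ℂ} (ha : a ≠ 0) {c s : ℕ → ℂ} {f g : ℂ → ℂ}
    (hf : IsStarContinuation a c f) (hg : IsStarContinuation a s g)
    (hrec : IsLogHeunSeq a q α β γ δ k c s) {z : ℂ} (hz : z ∈ starDomain a) :
    logHeunOp a q α β γ δ k f g z = 0 := by
  have hfa := hf.analyticOnNhd
  have hga := hg.analyticOnNhd
  have han : AnalyticOnNhd ℂ (logHeunOp a q α β γ δ k f g) (starDomain a) := by
    intro x hx
    have h0 := hfa x hx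
    have h1 := h0.deriv
    have h2 : AnalyticAt ℂ (deriv fun x => x * deriv f x) x :=
      AnalyticAt.deriv (analyticAt_id.mul h1)
    have h3 := hga x hx
    have h4 := h3.deriv
    unfold logHeunOp
    fun_prop
  suffices h0 : logHeunOp a q α β γ δ k f g =ᶠ[𝓝 0] fun _ => 0 from
    han.eqOn_of_preconnected_of_eventuallyEq analyticOnNhd_const (isPreconnected_starDomain ha)
      (zero_mem_starDomain ha) h0 hz
  filter_upwards [hf.2, hg.2, hasSum_theta hf.2, hasSum_theta hg.2,
    hasSum_theta (hasSum_theta hf.2)] with x f0 g0 f1 g1 f2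
  have e2 := (f2.add (f1.mul_left (γ - 1))).add
    (((g1.mul_left 2).add (g0.mul_left (γ - 1))).mul_left k)
  have e1 := f1.add (g0.mul_left k)
  have key := hasSum_opCoeff (A := ℂ) (Z := x) a q α β δ (eps α β γ δ)
    (y := fun m => m * (m * c m) + (γ - 1) * (m * c m) + k * (2 * (m * s m) + (γ - 1) * s m))
    (v := fun m => m * c m + k * s m) (w := c)
    (e2.congr_fun fun m => by simp only [smul_eq_mul]; ring)
    (e1.congr_fun fun m => by simp only [smul_eq_mul]; ring)
    (f0.congr_fun fun m => by simp only [smul_eq_mul])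
  simp only [opCoeff_eq_zero hrec, smul_eq_mul, mul_one, zero_mul] at key
  have := key.unique hasSum_zero
  unfold logHeunOp
  linear_combination this

lemma cutDomain_diff_eq (a : ℂ) : cutDomain a \ {0} = starDomain a ∩ Complex.slitPlane := by
  ext z
  simp only [cutDomain, Set.mem_sdiff, Set.mem_ofPred_eq, Set.mem_singleton_iff, Set.mem_inter_iff,
    Complex.mem_slitPlane_iff]
  constructor
  · rintro ⟨⟨h1, h2⟩, h3⟩
    refine ⟨h1, ?_⟩
    by_contra! h4
    refine h2 z.re (lt_of_le_of_ne h4.1 fun h5 => h3 (Complex.ext h5 h4.2)) ?_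
    exact Complex.ext (by simp) (by simp [h4.2])
  · rintro ⟨h1, h2⟩
    refine ⟨⟨h1, ?_⟩, ?_⟩
    · rintro t ht rfl
      simp only [Complex.ofReal_re, Complex.ofReal_im] at h2
      rcases h2 with h2 | h2
      · linarith
      · exact h2 rfl
    · rintro rfl
      simp at h2

lemma isOpen_cutDomain_diff (a : ℂ) : IsOpen (cutDomain a \ {0}) := by
  rw [cutDomain_diff_eq]
  exact (isOpen_starDomain a).inter Complex.isOpen_slitPlane

lemma IsHeunSolutionOn.mono {a q α β γ δ : ℂ} {V W : Set ℂ} {f : ℂ → ℂ}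
    (hf : IsHeunSolutionOn a q α β γ δ V f) (h : W ⊆ V) : IsHeunSolutionOn a q α β γ δ W f :=
  ⟨hf.1.mono h, fun z hz => hf.2 z (h hz)⟩

lemma logHeunOp_eq {a q α β γ δ k : ℂ} {f g : ℂ → ℂ} {z : ℂ} (hf : AnalyticAt ℂ f z) :
    logHeunOp a q α β γ δ k f g z
      = (z - 1) * (z - a) * (z * (deriv f z + z * deriv (deriv f) z) + (γ - 1) * (z * deriv f z)
      + k * (2 * (z * deriv g z) + (γ - 1) * g z))
    + z * ((δ * (z - a) + eps α β γ δ * (z - 1)) * (z * deriv f z + k * g z)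
      + (α * β * z - q) * f z) := by
  have h : HasDerivAt (fun x => x * deriv f x) (1 * deriv f z + z * deriv (deriv f) z) z :=
    (hasDerivAt_id z).mul hf.deriv.differentiableAt.hasDerivAt
  rw [logHeunOp, h.deriv, one_mul]

/-- The sequence `u` satisfies the full Heun recurrence. -/
def IsHeunSeq (a q α β γ δ : ℂ) (u : ℕ → ℂ) : Prop :=
  P a γ 1 * u 1 = Q a q α β γ δ 1 * u 0 ∧ IsHeunRec a q α β γ δ u

lemma IsHeunSeq.isLogHeunSeq {a q α β γ δ : ℂ} {u : ℕ → ℂ} (h : IsHeunSeq a q α β γ δ u)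
    (s : ℕ → ℂ) : IsLogHeunSeq a q α β γ δ 0 u s :=
  ⟨by rw [h.1]; ring, Or.inr rfl, fun m => by rw [h.2 m]; ring⟩

/-- A power series whose coefficients satisfy the Heun recurrence solves Heun's equation. -/
lemma IsStarContinuation.isHeunSolutionOn {a q α β γ δ : ℂ} (ha : a ≠ 0) {u : ℕ → ℂ} {f : ℂ → ℂ}
    (hf : IsStarContinuation a u f) (hu : IsHeunSeq a q α β γ δ u) :
    IsHeunSolutionOn a q α β γ δ (starDomain a \ {0}) f := by
  refine ⟨hf.1.mono Set.sdiff_subset, fun z hz => ?_⟩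
  have h := logHeunOp_eq_zero ha hf hf (hu.isLogHeunSeq u) hz.1
  rw [logHeunOp_eq (hf.analyticOnNhd z hz.1)] at h
  have h0 : z ≠ 0 := hz.2
  have h1 := ne_one_of_mem_starDomain hz.1
  have h2 := ne_of_mem_starDomain hz.1
  have h3 : z ^ 2 * (z - 1) * (z - a) ≠ 0 := by positivity
  refine (mul_eq_zero_iff_left h3).1 ?_
  rw [← h]
  field_simp
  ring

/-- The logarithmic solutions of Heun's equation. -/
lemma isHeunSolutionOn_log {a q α β γ δ k : ℂ} (ha : a ≠ 0) {c s : ℕ → ℂ} {f g : ℂ → ℂ}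
    (hf : IsStarContinuation a c f) (hg : IsStarContinuation a s g)
    (hc : IsLogHeunSeq a q α β γ δ k c s) (hs : IsHeunSeq a q α β γ δ s) (A : ℂ) :
    IsHeunSolutionOn a q α β γ δ (cutDomain a \ {0})
      (fun z => f z + (k * Complex.log z + A) * g z) := by
  have hV := isOpen_cutDomain_diff a
  have hstar : ∀ z ∈ cutDomain a \ {0}, z ∈ starDomain a := fun z hz => hz.1.1
  have hslit : ∀ z ∈ cutDomain a \ {0}, z ∈ Complex.slitPlane := fun z hz =>
    (cutDomain_diff_eq a ▸ hz : z ∈ starDomain a ∩ Complex.slitPlane).2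
  have hd1 : ∀ z ∈ cutDomain a \ {0},
      HasDerivAt (fun z => f z + (k * Complex.log z + A) * g z)
        (deriv f z + (k * z⁻¹ * g z + (k * Complex.log z + A) * deriv g z)) z := by
    intro z hz
    have hf1 := (hf.analyticOnNhd z (hstar z hz)).differentiableAt.hasDerivAt
    have hg1 := (hg.analyticOnNhd z (hstar z hz)).differentiableAt.hasDerivAt
    exact hf1.add ((((Complex.hasDerivAt_log (hslit z hz)).const_mul k).add_const A).mul hg1)
  refine ⟨fun z hz => (hd1 z hz).differentiableAt.differentiableWithinAt, fun z hz => ?_⟩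
  have hfa := hf.analyticOnNhd z (hstar z hz)
  have hga := hg.analyticOnNhd z (hstar z hz)
  have h0 : z ≠ 0 := hz.2
  have hd2 : HasDerivAt (deriv fun z => f z + (k * Complex.log z + A) * g z)
      (deriv (deriv f) z + ((k * -(z ^ 2)⁻¹ * g z + k * z⁻¹ * deriv g z)
        + (k * z⁻¹ * deriv g z + (k * Complex.log z + A) * deriv (deriv g) z))) z := by
    have h1 : (deriv fun z => f z + (k * Complex.log z + A) * g z) =ᶠ[𝓝 z]
        fun z => deriv f z + (k * z⁻¹ * g z + (k * Complex.log z + A) * deriv g z) := by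
      filter_upwards [hV.mem_nhds hz] with x hx using (hd1 x hx).deriv
    refine HasDerivAt.congr_of_eventuallyEq ?_ h1
    exact hfa.deriv.differentiableAt.hasDerivAt.add
      ((((hasDerivAt_inv h0).const_mul k).mul hga.differentiableAt.hasDerivAt).add
      ((((Complex.hasDerivAt_log (hslit z hz)).const_mul k).add_const A).mul
        hga.deriv.differentiableAt.hasDerivAt))
  rw [hd2.deriv, (hd1 z hz).deriv]
  have e1 := logHeunOp_eq_zero ha hf hg hc (hstar z hz)
  have e2 := logHeunOp_eq_zero ha hg hg (hs.isLogHeunSeq s) (hstar z hz)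
  rw [logHeunOp_eq hfa] at e1
  rw [logHeunOp_eq hga] at e2
  have h1 := ne_one_of_mem_starDomain (hstar z hz)
  have h2 := ne_of_mem_starDomain (hstar z hz)
  have h3 : z ^ 2 * (z - 1) * (z - a) ≠ 0 := by positivity
  refine (mul_eq_zero_iff_left h3).1 ?_
  -- The left-hand side is the identity for `f` plus `k * log z + A` times the one for `g`.
  have e3 : (0 : ℂ) = 0 + (k * Complex.log z + A) * 0 := by ring
  rw [e3]
  nth_rewrite 1 [← e1]
  rw [← e2]
  field_simp
  ring

/-! ### The coefficients of the local Heun functions -/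

lemma P_succ (a γ : ℂ) (m : ℕ) : P a γ (m + 1) = a * (m + 1) * (γ + m) := by
  simp only [P]
  push_cast
  ring

lemma P_succ_ne_zero {a γ : ℂ} (ha : a ≠ 0) {m : ℕ} (h : γ ≠ -(m : ℂ)) : P a γ (m + 1) ≠ 0 := by
  rw [P_succ]
  refine mul_ne_zero (mul_ne_zero ha (Nat.cast_add_one_ne_zero m)) ?_
  rwa [← sub_neg_eq_add, sub_ne_zero]

lemma ne_neg_natCast {γ : ℂ} (h : γ ∉ nonposInts) (m : ℕ) : γ ≠ -(m : ℂ) := fun e => h ⟨m, e⟩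

lemma heunCoeff_one_mul {a γ : ℂ} (q α β δ : ℂ) (h : P a γ 1 ≠ 0) :
    P a γ 1 * heunCoeff a q α β γ δ 1 = Q a q α β γ δ 1 * heunCoeff a q α β γ δ 0 := by
  rw [heunCoeff, heunCoeff]
  field_simp

lemma heunCoeff_add_two_mul {a γ : ℂ} (q α β δ : ℂ) {m : ℕ} (h : P a γ (m + 2) ≠ 0) :
    P a γ (m + 2) * heunCoeff a q α β γ δ (m + 2)
      = Q a q α β γ δ (m + 2) * heunCoeff a q α β γ δ (m + 1)
        + R α β (m + 2) * heunCoeff a q α β γ δ m := by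
  rw [heunCoeff]
  field_simp

lemma isHeunSeq_heunCoeff {a γ : ℂ} (ha : a ≠ 0) (q α β δ : ℂ) (h : γ ∉ nonposInts) :
    IsHeunSeq a q α β γ δ (heunCoeff a q α β γ δ) :=
  ⟨heunCoeff_one_mul q α β δ (P_succ_ne_zero ha (ne_neg_natCast h 0)),
    fun m => heunCoeff_add_two_mul q α β δ (P_succ_ne_zero ha (ne_neg_natCast h (m + 1)))⟩

lemma differentiableAt_heunCoeff {a δ : ℂ} {q α β γ : ℂ → ℂ} {w : ℂ} (hq : DifferentiableAt ℂ q w)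
    (hα : DifferentiableAt ℂ α w) (hβ : DifferentiableAt ℂ β w) (hγ : DifferentiableAt ℂ γ w) :
    ∀ m : ℕ, (∀ j < m, P a (γ w) (j + 1) ≠ 0) →
      DifferentiableAt ℂ (fun x => heunCoeff a (q x) (α x) (β x) (γ x) δ m) w
  | 0, _ => by
    simp only [heunCoeff]
    fun_prop
  | 1, h => by
    have h1 := h 0 (by omega)
    simp only [heunCoeff]
    refine DifferentiableAt.div ?_ ?_ h1
    · unfold Q eps
      fun_prop
    · unfold P
      fun_prop
  | m + 2, h => by
    have h1 := h (m + 1) (by omega)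
    have h2 := differentiableAt_heunCoeff (a := a) (δ := δ) hq hα hβ hγ (m + 1)
      fun j hj => h j (by omega)
    have h3 := differentiableAt_heunCoeff (a := a) (δ := δ) hq hα hβ hγ m
      fun j hj => h j (by omega)
    simp only [heunCoeff]
    refine DifferentiableAt.div ?_ ?_ h1
    · unfold Q R eps
      fun_prop
    · unfold P
      fun_prop

lemma isOpen_compl_nonposInts : IsOpen nonposIntsᶜ := by
  have h : nonposInts = Int.cast '' {k : ℤ | k ≤ 0} := by
    ext γ
    constructor
    · rintro ⟨n, rfl⟩
      exact ⟨-n, by simp, by simp⟩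
    · rintro ⟨k, hk, rfl⟩
      refine ⟨k.natAbs, ?_⟩
      have : (k : ℤ) = -(k.natAbs : ℤ) := by
        have : k ≤ 0 := hk
        omega
      rw [this]
      simp
  rw [isOpen_compl_iff, h]
  have hemb := Complex.isometry_ofReal.isClosedEmbedding.comp Real.isClosedEmbedding_intCast
  have hcoe : (Int.cast : ℤ → ℂ) = (fun x : ℝ => (x : ℂ)) ∘ (fun k : ℤ => (k : ℝ)) := by
    funext k
    simp
  rw [hcoe]
  exact hemb.isClosedMap _ (isClosed_discrete _)

/-! ### The second local solution -/

/-- The coefficients of the power series in `heunS`. -/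
def secondCoeff (a q α β γ δ : ℂ) : ℕ → ℂ :=
  heunCoeff a (q - (γ - 1) * (eps α β γ δ + a * δ)) (α - γ + 1) (β - γ + 1) (2 - γ) δ

/-- The local Heun functions form an analytic family. -/
lemma exists_heunL_family {a : ℂ} (ha : a ≠ 0) (q α β δ : ℂ) :
    ∃ H, IsAnalyticFamily a nonposIntsᶜ (fun γ => heunCoeff a q α β γ δ) H := by
  refine exists_isAnalyticFamily (δ := δ) (q := fun _ => q) (α := fun _ => α) (β := fun _ => β)
    (γ := fun γ => γ) ha isOpen_compl_nonposInts (by fun_prop) (by fun_prop) (by fun_prop)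
    (by fun_prop) (fun m γ hγ => ?_) (fun γ hγ => (isHeunSeq_heunCoeff ha q α β δ hγ).2)
  exact (differentiableAt_heunCoeff (q := fun _ => q) (α := fun _ => α) (β := fun _ => β)
    (γ := fun γ => γ) (by fun_prop) (by fun_prop) (by fun_prop) (by fun_prop) m
    fun j _ => P_succ_ne_zero ha (ne_neg_natCast hγ j)).differentiableWithinAt

/-- The half plane `Re γ < 1`. It contains the closed discs of radius `1 / 2` around the points
`-n`, and `heunS` depends holomorphically on `γ` there. -/
def leftHalf : Set ℂ := {γ | γ.re < 1}

lemma isOpen_leftHalf : IsOpen leftHalf := isOpen_lt Complex.continuous_re continuous_const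

lemma neg_natCast_mem_leftHalf (n : ℕ) : -(n : ℂ) ∈ leftHalf := by
  have : (0 : ℝ) ≤ n := Nat.cast_nonneg n
  simp only [leftHalf, Set.mem_ofPred_eq, Complex.neg_re, Complex.natCast_re]
  linarith

lemma two_sub_notMem_of_leftHalf {γ : ℂ} (h : γ ∈ leftHalf) : 2 - γ ∉ nonposInts := by
  rintro ⟨m, hm⟩
  have h1 := congrArg Complex.re hm
  simp only [Complex.sub_re, Complex.re_ofNat, Complex.neg_re, Complex.natCast_re] at h1
  have h2 : (0 : ℝ) ≤ m := Nat.cast_nonneg m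
  have h3 : γ.re < 1 := h
  linarith

lemma isHeunSeq_secondCoeff {a γ : ℂ} (ha : a ≠ 0) (q α β δ : ℂ) (hγ : γ ∈ leftHalf) :
    IsHeunSeq a (q - (γ - 1) * (eps α β γ δ + a * δ)) (α - γ + 1) (β - γ + 1) (2 - γ) δ
      (secondCoeff a q α β γ δ) :=
  isHeunSeq_heunCoeff ha _ _ _ δ (two_sub_notMem_of_leftHalf hγ)

lemma differentiableOn_secondCoeff {a : ℂ} (ha : a ≠ 0) (q α β δ : ℂ) (m : ℕ) :
    DifferentiableOn ℂ (fun γ => secondCoeff a q α β γ δ m) leftHalf := fun γ hγ =>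
  (differentiableAt_heunCoeff (γ := fun γ => 2 - γ) (by unfold eps; fun_prop) (by fun_prop)
    (by fun_prop) (by fun_prop) m fun j _ => P_succ_ne_zero ha
      (ne_neg_natCast (two_sub_notMem_of_leftHalf hγ) j)).differentiableWithinAt

lemma exists_second_family {a : ℂ} (ha : a ≠ 0) (q α β δ : ℂ) :
    ∃ H, IsAnalyticFamily a leftHalf (fun γ => secondCoeff a q α β γ δ) H :=
  exists_isAnalyticFamily (δ := δ) (q := fun γ => q - (γ - 1) * (eps α β γ δ + a * δ))
    (α := fun γ => α - γ + 1) (β := fun γ => β - γ + 1)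
    (γ := fun γ => 2 - γ) ha isOpen_leftHalf (by unfold eps; fun_prop) (by fun_prop) (by fun_prop)
    (by fun_prop) (differentiableOn_secondCoeff ha q α β δ)
    fun _ hγ => (isHeunSeq_secondCoeff ha q α β δ hγ).2

/-! ### The coefficients at `γ = -n` -/

section Coefficients

variable (a q α β δ : ℂ) (n : ℕ)

lemma P_neg_ne_zero {a : ℂ} (ha : a ≠ 0) {n m : ℕ} (h : n ≤ m) : P a (-(n : ℂ)) (m + 2) ≠ 0 :=
  P_succ_ne_zero (m := m + 1) ha fun e => by
    have : n = m + 1 := by exact_mod_cast neg_injective e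
    omega

lemma P_neg_ne_zero' {a : ℂ} (ha : a ≠ 0) {n m : ℕ} (h : m < n) : P a (-(n : ℂ)) (m + 1) ≠ 0 :=
  P_succ_ne_zero ha fun e => by
    have : n = m := by exact_mod_cast neg_injective e
    omega

lemma sCoeff_of_le {m : ℕ} (h : m ≤ n) : sCoeff a q α β δ n m = 0 := by
  rcases m with _ | _ | m
  · rfl
  · rw [sCoeff, if_neg (by omega)]
  · rw [sCoeff, if_pos h]

lemma sCoeff_succ_self : sCoeff a q α β δ n (n + 1) = 1 := by
  rcases n with _ | n
  · rw [sCoeff, if_pos rfl]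
  · rw [sCoeff, if_neg (by omega), if_pos rfl]

lemma sCoeff_add_two_mul (ha : a ≠ 0) {m : ℕ} (h : n ≤ m) :
    P a (-(n : ℂ)) (m + 2) * sCoeff a q α β δ n (m + 2)
      = Q a q α β (-(n : ℂ)) δ (m + 2) * sCoeff a q α β δ n (m + 1)
        + R α β (m + 2) * sCoeff a q α β δ n m := by
  rw [sCoeff, if_neg (by omega), if_neg (by omega)]
  field_simp [P_neg_ne_zero ha h]

lemma cCoeff_of_le {m : ℕ} (h : m ≤ n) :
    cCoeff a q α β δ n m = heunCoeff a q α β (-(n : ℂ)) δ m := by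
  rcases m with _ | _ | m
  · rw [cCoeff, heunCoeff]
  · rw [cCoeff, if_neg (by omega)]
  · rw [cCoeff, if_pos h]

lemma cCoeff_succ_self : cCoeff a q α β δ n (n + 1) = 0 := by
  rcases n with _ | n
  · rw [cCoeff, if_pos rfl]
  · rw [cCoeff, if_neg (by omega), if_pos rfl]

lemma cCoeff_add_two_mul (ha : a ≠ 0) {m : ℕ} (h : n ≤ m) :
    P a (-(n : ℂ)) (m + 2) * cCoeff a q α β δ n (m + 2)
      = Q a q α β (-(n : ℂ)) δ (m + 2) * cCoeff a q α β δ n (m + 1)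
        + R α β (m + 2) * cCoeff a q α β δ n m
        + logConst a q α β δ n *
        (S a (-(n : ℂ)) (m + 2) * sCoeff a q α β δ n (m + 2)
          + T a α β (-(n : ℂ)) δ (m + 2) * sCoeff a q α β δ n (m + 1)
          + U α β (m + 2) * sCoeff a q α β δ n m) := by
  rw [cCoeff, if_neg (by omega), if_neg (by omega)]
  field_simp [P_neg_ne_zero ha h]

/-- The coefficient of the logarithm is the residue of `HeunL` at `γ = -n`. -/
lemma logConst_eq_K : logConst a q α β δ n = K a q α β δ n := by
  simp only [logConst, K, Q, R, eps]
  congr 1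
  push_cast
  ring

lemma K_mul (ha : a ≠ 0) : K a q α β δ n * (a * (n + 1))
    = Q a q α β (-(n : ℂ)) δ (n + 1) * cPrev a q α β δ n (n + 1)
      + R α β (n + 1) * cPrev a q α β δ n n := by
  have := Nat.cast_add_one_ne_zero (R := ℂ) n
  rw [K]
  field_simp

lemma isHeunSeq_sCoeff (ha : a ≠ 0) : IsHeunSeq a q α β (-(n : ℂ)) δ (sCoeff a q α β δ n) := by
  have hP : P a (-(n : ℂ)) (n + 1) = 0 := by rw [P_succ]; ring
  constructor
  · rcases n with _ | n
    · rw [hP, sCoeff_of_le a q α β δ 0 le_rfl]; ring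
    · rw [sCoeff_of_le _ _ _ _ _ _ (by omega), sCoeff_of_le _ _ _ _ _ _ (by omega)]; ring
  · intro m
    rcases lt_trichotomy (m + 1) n with h | h | h
    · rw [sCoeff_of_le _ _ _ _ _ _ (by omega), sCoeff_of_le _ _ _ _ _ _ (by omega),
        sCoeff_of_le _ _ _ _ _ _ (by omega)]
      ring
    · subst h
      rw [hP, sCoeff_of_le _ _ _ _ _ _ (le_refl (m + 1)),
        sCoeff_of_le _ _ _ _ _ _ (Nat.le_succ m)]
      ring
    · exact sCoeff_add_two_mul a q α β δ n ha (by omega)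

/-- At the index `n + 1` the factor `P` vanishes, and the recurrence holds because the constant in
front of the logarithm is the right one. -/
lemma isLogHeunSeq_cCoeff (ha : a ≠ 0) : IsLogHeunSeq a q α β (-(n : ℂ)) δ (logConst a q α β δ n)
    (cCoeff a q α β δ n) (sCoeff a q α β δ n) := by
  have hP : P a (-(n : ℂ)) (n + 1) = 0 := by rw [P_succ]; ring
  have hS : S a (-(n : ℂ)) (n + 1) = -(a * (n + 1)) := by
    simp only [S]
    push_cast
    ring
  have hK := K_mul a q α β δ n ha
  refine ⟨?_, Or.inl (by rw [sCoeff_of_le _ _ _ _ _ _ (by omega), mul_zero]), fun m => ?_⟩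
  · rcases n with _ | n
    · rw [hP, hS, logConst_eq_K, sCoeff_succ_self, sCoeff_of_le _ _ _ _ _ _ le_rfl,
        cCoeff_of_le _ _ _ _ _ _ le_rfl]
      simp only [cPrev] at hK
      linear_combination hK
    · rw [sCoeff_of_le _ _ _ _ _ _ (by omega), sCoeff_of_le _ _ _ _ _ _ (by omega),
        cCoeff_of_le _ _ _ _ _ _ (by omega), cCoeff_of_le _ _ _ _ _ _ (by omega),
        heunCoeff_one_mul _ _ _ _ (P_neg_ne_zero' ha (by omega))]
      ring
  · rcases lt_trichotomy (m + 1) n with h | h | h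
    · rw [sCoeff_of_le _ _ _ _ _ _ (by omega), sCoeff_of_le _ _ _ _ _ _ (by omega),
        sCoeff_of_le _ _ _ _ _ _ (by omega), cCoeff_of_le _ _ _ _ _ _ (by omega),
        cCoeff_of_le _ _ _ _ _ _ (by omega), cCoeff_of_le _ _ _ _ _ _ (by omega),
        heunCoeff_add_two_mul _ _ _ _ (P_neg_ne_zero' ha h)]
      ring
    · subst h
      rw [hP, hS, logConst_eq_K, sCoeff_succ_self, sCoeff_of_le _ _ _ _ _ _ le_rfl,
        sCoeff_of_le _ _ _ _ _ _ (Nat.le_succ m), cCoeff_of_le _ _ _ _ _ _ le_rfl,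
        cCoeff_of_le _ _ _ _ _ _ (Nat.le_succ m)]
      simp only [cPrev] at hK
      linear_combination hK
    · exact cCoeff_add_two_mul a q α β δ n ha (by omega)

/-- At `γ = -n` the exponents at the origin differ by `n + 1`: the recurrence of `heunS` is the
one of `heunL`, shifted by `n + 1`. -/
lemma sCoeff_eq_secondCoeff (ha : a ≠ 0) (j : ℕ) :
    sCoeff a q α β δ n (n + 1 + j) = secondCoeff a q α β (-(n : ℂ)) δ j := by
  obtain ⟨h1, h2⟩ := isHeunSeq_secondCoeff ha q α β δ (neg_natCast_mem_leftHalf n)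
  have key : ∀ i, P a (-(n : ℂ)) (n + i + 2)
      = P a (2 - -(n : ℂ)) (i + 1) := by
    intro i
    simp only [P]
    push_cast
    ring
  have keyQ : ∀ i, Q a q α β (-(n : ℂ)) δ (n + i + 2)
      = Q a (q - (-(n : ℂ) - 1) * (eps α β (-(n : ℂ)) δ + a * δ)) (α - -(n : ℂ) + 1)
        (β - -(n : ℂ) + 1) (2 - -(n : ℂ)) δ (i + 1) := by
    intro i
    simp only [Q, eps]
    push_cast
    ring
  induction j using Nat.strong_induction_on with
  | _ j ih =>
    rcases j with _ | _ | j
    · rw [add_zero, sCoeff_succ_self, secondCoeff, heunCoeff]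
    · have h3 := sCoeff_add_two_mul a q α β δ n ha le_rfl
      have h4 := P_neg_ne_zero ha (le_refl n)
      have h5 := ih 0 (by omega)
      have h6 := key 0
      have h7 := keyQ 0
      simp only [add_zero, zero_add] at h5 h6 h7 ⊢
      rw [sCoeff_of_le _ _ _ _ _ _ le_rfl, h5, h7, mul_zero, add_zero] at h3
      refine mul_left_cancel₀ h4 ?_
      rw [show n + 1 + 1 = n + 2 by ring, h3, h6, h1]
    · have h3 := sCoeff_add_two_mul a q α β δ n ha (m := n + 1 + j) (by omega)
      have h4 := P_neg_ne_zero ha (show n ≤ n + 1 + j by omega)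
      have h5 := ih j (by omega)
      have h6 := ih (j + 1) (by omega)
      have h7 := key (j + 1)
      have h8 := keyQ (j + 1)
      have h9 : R α β (n + 1 + j + 2) = R (α - -(n : ℂ) + 1) (β - -(n : ℂ) + 1) (j + 2) := by
        simp only [R]
        push_cast
        ring
      rw [show n + (j + 1) + 2 = n + 1 + j + 2 by ring] at h7 h8
      rw [← add_assoc] at h6
      refine mul_left_cancel₀ h4 ?_
      rw [← add_assoc (n + 1) j 2, h3, h5, h6, h7, h8, h9]
      exact (h2 j).symm

/-! ### The residue at `γ = -n` -/

/-- The coefficients of `(γ + n) * HeunL`, which are regular at `γ = -n`. -/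
def resCoeff (a q α β γ δ : ℂ) (n : ℕ) : ℕ → ℂ
  | 0 => γ + n
  | 1 => if n = 0 then Q a q α β γ δ 1 / a else (γ + n) * heunCoeff a q α β γ δ 1
  | m + 2 =>
    if m + 2 ≤ n then (γ + n) * heunCoeff a q α β γ δ (m + 2)
    else if m + 2 = n + 1 then
      (Q a q α β γ δ (m + 2) * heunCoeff a q α β γ δ (m + 1)
        + R α β (m + 2) * heunCoeff a q α β γ δ m) / (a * (m + 2))
    else (Q a q α β γ δ (m + 2) * resCoeff a q α β γ δ n (m + 1)
      + R α β (m + 2) * resCoeff a q α β γ δ n m) / P a γ (m + 2)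

lemma resCoeff_of_le (γ : ℂ) {m : ℕ} (h : m ≤ n) :
    resCoeff a q α β γ δ n m = (γ + n) * heunCoeff a q α β γ δ m := by
  rcases m with _ | _ | m
  · rw [resCoeff, heunCoeff, mul_one]
  · rw [resCoeff, if_neg (by omega)]
  · rw [resCoeff, if_pos h]

lemma ne_neg_natCast_of_mem_ball {γ : ℂ} {n m : ℕ} (hγ : γ ∈ Metric.ball (-(n : ℂ)) 1)
    (h : m ≠ n) : γ ≠ -(m : ℂ) := by
  rintro rfl
  rw [Metric.mem_ball, dist_eq_norm, show -(m : ℂ) - -(n : ℂ) = (((n : ℤ) - m : ℤ) : ℂ) by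
    push_cast; ring, Complex.norm_intCast] at hγ
  have h1 : |(n : ℤ) - m| < 1 := by exact_mod_cast hγ
  have := abs_lt.1 h1
  omega

lemma resCoeff_add_two_mul {γ : ℂ} (ha : a ≠ 0) (hγ : γ ∈ Metric.ball (-(n : ℂ)) 1) {m : ℕ}
    (h : n ≤ m) :
    P a γ (m + 2) * resCoeff a q α β γ δ n (m + 2)
      = Q a q α β γ δ (m + 2) * resCoeff a q α β γ δ n (m + 1)
        + R α β (m + 2) * resCoeff a q α β γ δ n m := by
  have h1 : P a γ (m + 2) ≠ 0 :=
    P_succ_ne_zero (m := m + 1) ha (ne_neg_natCast_of_mem_ball hγ (by omega))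
  rw [resCoeff, if_neg (by omega), if_neg (by omega)]
  field_simp

lemma isHeunRec_resCoeff {γ : ℂ} (ha : a ≠ 0) (hγ : γ ∈ Metric.ball (-(n : ℂ)) 1) :
    IsHeunRec a q α β γ δ (resCoeff a q α β γ δ n) := by
  intro m
  rcases lt_trichotomy (m + 1) n with h | h | h
  · have h1 : P a γ (m + 2) ≠ 0 :=
      P_succ_ne_zero (m := m + 1) ha (ne_neg_natCast_of_mem_ball hγ (by omega))
    have h2 := heunCoeff_add_two_mul q α β δ h1
    rw [resCoeff_of_le _ _ _ _ _ _ _ (by omega), resCoeff_of_le _ _ _ _ _ _ _ (by omega),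
      resCoeff_of_le _ _ _ _ _ _ _ (by omega)]
    linear_combination (γ + n) * h2
  · subst h
    rw [resCoeff_of_le _ _ _ _ _ _ _ (le_refl (m + 1)),
      resCoeff_of_le _ _ _ _ _ _ _ (Nat.le_succ m), resCoeff, if_neg (by omega), if_pos rfl, show m + 2 = m + 1 + 1 from rfl, P_succ]
    have h3 : (m : ℂ) + 2 ≠ 0 := by exact_mod_cast Nat.succ_ne_zero (m + 1)
    push_cast
    field_simp
    ring
  · exact resCoeff_add_two_mul a q α β δ n ha hγ (by omega)

lemma differentiableAt_heunCoeff_ball {γ : ℂ} (ha : a ≠ 0) (hγ : γ ∈ Metric.ball (-(n : ℂ)) 1)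
    {m : ℕ} (hm : m ≤ n) : DifferentiableAt ℂ (fun γ => heunCoeff a q α β γ δ m) γ :=
  differentiableAt_heunCoeff (q := fun _ => q) (α := fun _ => α) (β := fun _ => β)
    (γ := fun γ => γ) (by fun_prop) (by fun_prop) (by fun_prop) (by fun_prop) m
    fun _ hj => P_succ_ne_zero ha (ne_neg_natCast_of_mem_ball hγ (by omega))

lemma differentiableAt_resCoeff {γ : ℂ} (ha : a ≠ 0) (hγ : γ ∈ Metric.ball (-(n : ℂ)) 1) (m : ℕ) :
    DifferentiableAt ℂ (fun γ => resCoeff a q α β γ δ n m) γ := by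
  have hQ : ∀ m, DifferentiableAt ℂ (fun γ => Q a q α β γ δ m) γ := fun m => by
    unfold Q eps
    fun_prop
  induction m using Nat.strong_induction_on with
  | _ m ih =>
    by_cases hm : m ≤ n
    · simp only [resCoeff_of_le a q α β δ n _ hm]
      have := differentiableAt_heunCoeff_ball a q α β δ n ha hγ hm
      fun_prop
    · rcases m with _ | _ | m
      · omega
      · simp only [resCoeff, if_pos (show n = 0 by omega)]
        have := hQ 1
        fun_prop
      · by_cases hm' : m + 2 = n + 1
        · simp only [resCoeff, if_neg hm, if_pos hm']
          have h1 := differentiableAt_heunCoeff_ball a q α β δ n ha hγ (m := m + 1) (by omega)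
          have h2 := differentiableAt_heunCoeff_ball a q α β δ n ha hγ (m := m) (by omega)
          have h3 := hQ (m + 2)
          fun_prop
        · simp only [resCoeff, if_neg hm, if_neg hm']
          have h1 := ih (m + 1) (by omega)
          have h2 := ih m (by omega)
          have h3 := hQ (m + 2)
          refine DifferentiableAt.div (by fun_prop) (by unfold P; fun_prop) ?_
          exact P_succ_ne_zero (m := m + 1) ha (ne_neg_natCast_of_mem_ball hγ (by omega))

lemma exists_res_family (ha : a ≠ 0) : ∃ H, IsAnalyticFamily a (Metric.ball (-(n : ℂ)) 1)
    (fun γ => resCoeff a q α β γ δ n) H :=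
  exists_isAnalyticFamily (δ := δ) (q := fun _ => q) (α := fun _ => α) (β := fun _ => β)
    (γ := fun γ => γ) ha Metric.isOpen_ball (by fun_prop) (by fun_prop) (by fun_prop)
    (by fun_prop)
    (fun m _ hγ => (differentiableAt_resCoeff a q α β δ n ha hγ m).differentiableWithinAt)
    (fun _ hγ => isHeunRec_resCoeff a q α β δ n ha hγ)

lemma resCoeff_eq_mul {γ : ℂ} (ha : a ≠ 0) (hγ : γ ∈ Metric.ball (-(n : ℂ)) 1)
    (hne : γ ≠ -(n : ℂ)) (m : ℕ) :
    resCoeff a q α β γ δ n m = (γ + n) * heunCoeff a q α β γ δ m := by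
  have hP : ∀ j, P a γ (j + 1) ≠ 0 := by
    intro j
    by_cases hj : j = n
    · exact P_succ_ne_zero ha (hj ▸ hne)
    · exact P_succ_ne_zero ha (ne_neg_natCast_of_mem_ball hγ hj)
  induction m using Nat.strong_induction_on with
  | _ m ih =>
    rcases m with _ | _ | m
    · rw [resCoeff, heunCoeff, mul_one]
    · by_cases h0 : n = 0
      · subst h0
        have h1 : γ ≠ 0 := by simpa using hne
        rw [resCoeff, if_pos rfl, heunCoeff, show (1 : ℕ) = 0 + 1 from rfl, P_succ]
        simp
        field_simp
      · exact resCoeff_of_le _ _ _ _ _ _ _ (by omega)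
    · have h1 := isHeunRec_resCoeff a q α β δ n ha hγ m
      have h2 := heunCoeff_add_two_mul q α β δ (hP (m + 1))
      refine mul_left_cancel₀ (hP (m + 1)) ?_
      rw [h1, ih (m + 1) (by omega), ih m (by omega)]
      linear_combination (-(γ + n)) * h2

lemma resCoeff_neg (ha : a ≠ 0) (m : ℕ) :
    resCoeff a q α β (-(n : ℂ)) δ n m = K a q α β δ n * sCoeff a q α β δ n m := by
  have hb : -(n : ℂ) ∈ Metric.ball (-(n : ℂ)) 1 := Metric.mem_ball_self one_pos
  have hK := K_mul a q α β δ n ha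
  induction m using Nat.strong_induction_on with
  | _ m ih =>
    rcases lt_trichotomy m (n + 1) with h | h | h
    · rw [resCoeff_of_le _ _ _ _ _ _ _ (by omega), sCoeff_of_le _ _ _ _ _ _ (by omega)]
      ring
    · subst h
      rw [sCoeff_succ_self, mul_one]
      have h3 : (n : ℂ) + 1 ≠ 0 := Nat.cast_add_one_ne_zero n
      rcases n with _ | n
      · rw [resCoeff, if_pos rfl]
        simp only [cPrev, heunCoeff] at hK
        push_cast at hK ⊢
        rw [div_eq_iff ha]
        linear_combination -hK
      · rw [resCoeff, if_neg (by omega), if_pos rfl]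
        simp only [cPrev] at hK
        push_cast at hK h3 ⊢
        have h4 : (n : ℂ) + 2 ≠ 0 := by convert h3 using 1; ring
        rw [div_eq_iff (mul_ne_zero ha h4)]
        linear_combination -hK
    · obtain ⟨k, rfl⟩ : ∃ k, m = k + 2 := ⟨m - 2, by omega⟩
      have h1 := resCoeff_add_two_mul a q α β δ n ha hb (m := k) (by omega)
      have h2 := sCoeff_add_two_mul a q α β δ n ha (m := k) (by omega)
      refine mul_left_cancel₀ (P_neg_ne_zero ha (show n ≤ k by omega)) ?_
      rw [h1, ih (k + 1) (by omega), ih k (by omega)]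
      linear_combination (-(K a q α β δ n)) * h2

end Coefficients

/-! ### Differentiating the recurrences at `γ = -n` -/

section Limit

variable (a q α β δ : ℂ) (n : ℕ)

/-- The coefficients of the power series in `heunS`, with indices shifted by `n + 1`. -/
def shiftedSecondCoeff (γ : ℂ) (m : ℕ) : ℂ :=
  if n + 1 ≤ m then secondCoeff a q α β γ δ (m - (n + 1)) else 0

lemma shiftedSecondCoeff_add (γ : ℂ) (j : ℕ) :
    shiftedSecondCoeff a q α β δ n γ (n + 1 + j) = secondCoeff a q α β γ δ j := by
  rw [shiftedSecondCoeff, if_pos (by omega), Nat.add_sub_cancel_left]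

lemma shiftedSecondCoeff_of_le (γ : ℂ) {m : ℕ} (h : m ≤ n) :
    shiftedSecondCoeff a q α β δ n γ m = 0 := by
  rw [shiftedSecondCoeff, if_neg (by omega)]

lemma shiftedSecondCoeff_neg (ha : a ≠ 0) (m : ℕ) :
    shiftedSecondCoeff a q α β δ n (-(n : ℂ)) m = sCoeff a q α β δ n m := by
  by_cases h : m ≤ n
  · rw [shiftedSecondCoeff_of_le _ _ _ _ _ _ _ h, sCoeff_of_le _ _ _ _ _ _ h]
  · obtain ⟨j, rfl⟩ : ∃ j, m = n + 1 + j := ⟨m - (n + 1), by omega⟩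
    rw [shiftedSecondCoeff_add, sCoeff_eq_secondCoeff a q α β δ n ha]

lemma differentiableAt_shiftedSecondCoeff (ha : a ≠ 0) {γ : ℂ} (hγ : γ ∈ leftHalf) (m : ℕ) :
    DifferentiableAt ℂ (fun γ => shiftedSecondCoeff a q α β δ n γ m) γ := by
  by_cases h : n + 1 ≤ m
  · simp only [shiftedSecondCoeff, if_pos h]
    exact (differentiableOn_secondCoeff ha q α β δ _).differentiableAt
      (isOpen_leftHalf.mem_nhds hγ)
  · simp only [shiftedSecondCoeff, if_neg h]
    fun_prop

lemma shiftedSecondCoeff_rec (ha : a ≠ 0) {γ : ℂ} (hγ : γ ∈ leftHalf) (i : ℕ) :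
    a * (i + 1) * (2 - γ + i) * shiftedSecondCoeff a q α β δ n γ (n + i + 2)
      = (q - (γ - 1) * (α + β + 1 - γ - δ + a * δ)
          + i * ((a + 1) * (1 - γ + i) + (α + β + 1 - γ - δ) + a * δ))
          * shiftedSecondCoeff a q α β δ n γ (n + i + 1)
        + -((i + α - γ) * (i + β - γ)) * shiftedSecondCoeff a q α β δ n γ (n + i) := by
  obtain ⟨h1, h2⟩ := isHeunSeq_secondCoeff ha q α β δ hγ
  rcases i with _ | i
  · rw [shiftedSecondCoeff_of_le _ _ _ _ _ _ _ (show n + 0 ≤ n by omega),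
      show n + 0 + 2 = n + 1 + 1 by ring, show n + 0 + 1 = n + 1 + 0 by ring,
      shiftedSecondCoeff_add, shiftedSecondCoeff_add]
    simp only [P, Q, eps] at h1
    push_cast at h1 ⊢
    linear_combination h1
  · rw [show n + (i + 1) + 2 = n + 1 + (i + 2) by ring,
      show n + (i + 1) + 1 = n + 1 + (i + 1) by ring, show n + (i + 1) = n + 1 + i by ring,
      shiftedSecondCoeff_add, shiftedSecondCoeff_add, shiftedSecondCoeff_add]
    have h3 := h2 i
    simp only [P, Q, R, eps] at h3
    push_cast at h3 ⊢
    linear_combination h3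

/-- The derivative at `γ = -n` of the recurrence for the coefficients of `heunS`. -/
lemma deriv_shiftedSecondCoeff_rec (ha : a ≠ 0) (i : ℕ) :
    -(a * (i + 1)) * sCoeff a q α β δ n (n + i + 2)
        + a * (i + 1) * (2 + n + i)
          * deriv (fun γ => shiftedSecondCoeff a q α β δ n γ (n + i + 2)) (-(n : ℂ))
      = (-(α + β + 1 + n - δ + a * δ) - (n + 1) - i * (a + 2)) * sCoeff a q α β δ n (n + i + 1)
        + (q + (n + 1) * (α + β + 1 + n - δ + a * δ)
          + i * ((a + 1) * (1 + n + i) + (α + β + 1 + n - δ) + a * δ))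
          * deriv (fun γ => shiftedSecondCoeff a q α β δ n γ (n + i + 1)) (-(n : ℂ))
        + ((2 * (n + i) + α + β) * sCoeff a q α β δ n (n + i)
          + -((i + α + n) * (i + β + n))
          * deriv (fun γ => shiftedSecondCoeff a q α β δ n γ (n + i)) (-(n : ℂ))) := by
  have hmem := neg_natCast_mem_leftHalf n
  have hd : ∀ m, HasDerivAt (fun γ => shiftedSecondCoeff a q α β δ n γ m)
      (deriv (fun γ => shiftedSecondCoeff a q α β δ n γ m) (-(n : ℂ))) (-(n : ℂ)) := fun m =>
    (differentiableAt_shiftedSecondCoeff a q α β δ n ha hmem m).hasDerivAt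
  have hid := hasDerivAt_id (-(n : ℂ))
  have hε := (hid.const_sub (α + β + 1)).sub_const δ
  have e1 := (((hid.const_sub 2).add_const (i : ℂ)).const_mul (a * (i + 1))).mul (hd (n + i + 2))
  have e2 := ((((hid.sub_const 1).mul (hε.add_const (a * δ))).const_sub q).add
    ((((((hid.const_sub 1).add_const (i : ℂ)).const_mul (a + 1)).add hε).add_const
      (a * δ)).const_mul (i : ℂ))).mul (hd (n + i + 1))
  have e3 := (((hid.const_sub (i + α)).mul (hid.const_sub (i + β))).neg).mul (hd (n + i))
  have heq : (fun γ => a * (i + 1) * (2 - γ + i)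
      * shiftedSecondCoeff a q α β δ n γ (n + i + 2)) =ᶠ[𝓝 (-(n : ℂ))] fun γ =>
      (q - (γ - 1) * (α + β + 1 - γ - δ + a * δ)
          + i * ((a + 1) * (1 - γ + i) + (α + β + 1 - γ - δ) + a * δ))
          * shiftedSecondCoeff a q α β δ n γ (n + i + 1)
        + -((i + α - γ) * (i + β - γ)) * shiftedSecondCoeff a q α β δ n γ (n + i) := by
    filter_upwards [isOpen_leftHalf.mem_nhds hmem] with γ hγ
    exact shiftedSecondCoeff_rec a q α β δ n ha hγ i
  have key := (e1.congr_of_eventuallyEq heq.symm).unique (e2.add e3)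
  simp only [id, Pi.add_apply, Pi.mul_apply, Pi.neg_apply,
    shiftedSecondCoeff_neg a q α β δ n ha] at key
  linear_combination key

/-- The derivative at `γ = -n` of the recurrence for the coefficients of `(γ + n) * HeunL`. -/
lemma deriv_resCoeff_rec (ha : a ≠ 0) {m : ℕ} (h : n ≤ m) :
    a * (m + 2) * (K a q α β δ n * sCoeff a q α β δ n (m + 2))
        + P a (-(n : ℂ)) (m + 2) * deriv (fun γ => resCoeff a q α β γ δ n (m + 2)) (-(n : ℂ))
      = (m + 1) * a * (K a q α β δ n * sCoeff a q α β δ n (m + 1))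
        + Q a q α β (-(n : ℂ)) δ (m + 2)
          * deriv (fun γ => resCoeff a q α β γ δ n (m + 1)) (-(n : ℂ))
        + R α β (m + 2) * deriv (fun γ => resCoeff a q α β γ δ n m) (-(n : ℂ)) := by
  have hb : -(n : ℂ) ∈ Metric.ball (-(n : ℂ)) 1 := Metric.mem_ball_self one_pos
  have hd : ∀ m, HasDerivAt (fun γ => resCoeff a q α β γ δ n m)
      (deriv (fun γ => resCoeff a q α β γ δ n m) (-(n : ℂ))) (-(n : ℂ)) := fun m =>
    (differentiableAt_resCoeff a q α β δ n ha hb m).hasDerivAt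
  have hid := hasDerivAt_id (-(n : ℂ))
  have hP : HasDerivAt (fun γ => P a γ (m + 2)) (a * (m + 2)) (-(n : ℂ)) := by
    have := ((hid.sub_const 1).add_const ((m + 2 : ℕ) : ℂ)).const_mul (a * ((m + 2 : ℕ) : ℂ))
    refine this.congr_deriv ?_
    push_cast
    ring
  have hQ : HasDerivAt (fun γ => Q a q α β γ δ (m + 2)) ((m + 1) * a) (-(n : ℂ)) := by
    have := ((((((hid.add_const ((m + 2 : ℕ) : ℂ)).sub_const 2).const_mul (a + 1)).add
      ((hid.const_sub (α + β + 1)).sub_const δ)).add_const (a * δ)).const_mul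
      (((m + 2 : ℕ) : ℂ) - 1)).const_add q
    refine this.congr_deriv ?_
    push_cast
    ring
  have e1 := hP.mul (hd (m + 2))
  have e2 := (hQ.mul (hd (m + 1))).add ((hd m).const_mul (R α β (m + 2)))
  have heq : (fun γ => P a γ (m + 2) * resCoeff a q α β γ δ n (m + 2)) =ᶠ[𝓝 (-(n : ℂ))] fun γ =>
      Q a q α β γ δ (m + 2) * resCoeff a q α β γ δ n (m + 1)
        + R α β (m + 2) * resCoeff a q α β γ δ n m := by
    filter_upwards [Metric.ball_mem_nhds (-(n : ℂ)) one_pos] with γ hγ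
    exact resCoeff_add_two_mul a q α β δ n ha hγ h
  have key := (e1.congr_of_eventuallyEq heq.symm).unique e2
  simpa only [resCoeff_neg a q α β δ n ha] using key

/-- The value of the free constant `A` for which the logarithmic solution is the limit of
`heunComb`. -/
def limitConst : ℂ :=
  deriv (fun γ => resCoeff a q α β γ δ n (n + 1)) (-(n : ℂ))
    - K a q α β δ n * deriv (fun γ => shiftedSecondCoeff a q α β δ n γ (n + 1)) (-(n : ℂ))

/-- The recurrence of `cCoeff` arises by differentiating in `γ` the recurrences of
`(γ + n) * HeunL` and of `HeunS` at `γ = -n`. -/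
lemma cCoeff_eq_deriv (ha : a ≠ 0) (m : ℕ) :
    cCoeff a q α β δ n m
      = deriv (fun γ => resCoeff a q α β γ δ n m) (-(n : ℂ))
        - K a q α β δ n * deriv (fun γ => shiftedSecondCoeff a q α β δ n γ m) (-(n : ℂ))
        - limitConst a q α β δ n * sCoeff a q α β δ n m := by
  have hb : -(n : ℂ) ∈ Metric.ball (-(n : ℂ)) 1 := Metric.mem_ball_self one_pos
  induction m using Nat.strong_induction_on with
  | _ m ih =>
    rcases lt_trichotomy m (n + 1) with h | h | h
    · have h' : m ≤ n := by omega
      have h1 : HasDerivAt (fun γ => resCoeff a q α β γ δ n m)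
          (heunCoeff a q α β (-(n : ℂ)) δ m) (-(n : ℂ)) := by
        simp only [resCoeff_of_le a q α β δ n _ h']
        have h2 := ((hasDerivAt_id (-(n : ℂ))).add_const (n : ℂ)).mul
          (differentiableAt_heunCoeff_ball a q α β δ n ha hb h').hasDerivAt
        refine h2.congr_deriv ?_
        simp
      have h3 : deriv (fun γ => shiftedSecondCoeff a q α β δ n γ m) (-(n : ℂ)) = 0 := by
        simp only [shiftedSecondCoeff_of_le a q α β δ n _ h', deriv_const]
      rw [h1.deriv, h3, sCoeff_of_le _ _ _ _ _ _ h', cCoeff_of_le _ _ _ _ _ _ h']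
      ring
    · subst h
      rw [cCoeff_succ_self, sCoeff_succ_self, limitConst]
      ring
    · obtain ⟨i, rfl⟩ : ∃ i, m = n + i + 2 := ⟨m - (n + 2), by omega⟩
      have hle : n ≤ n + i := by omega
      refine mul_left_cancel₀ (P_neg_ne_zero ha hle) ?_
      have h1 := cCoeff_add_two_mul a q α β δ n ha hle
      have h2 := sCoeff_add_two_mul a q α β δ n ha hle
      have h3 := deriv_resCoeff_rec a q α β δ n ha hle
      have h4 := deriv_shiftedSecondCoeff_rec a q α β δ n ha i
      rw [logConst_eq_K, ih (n + i) (by omega), ih (n + i + 1) (by omega)] at h1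
      rw [h1]
      have eP : P a (-(n : ℂ)) (n + i + 2) = a * (i + 1) * (2 + n + i) := by
        simp only [P]; push_cast; ring
      simp only [P, Q, R, S, T, U, eps] at *
      push_cast at *
      linear_combination (-h3) + K a q α β δ n * h4 + limitConst a q α β δ n * h2

/-! ### The limit at `γ = -n` -/

lemma isStarContinuation_heunL (ha : a ≠ 0) {γ : ℂ} (hγ : γ ∉ nonposInts) :
    IsStarContinuation a (heunCoeff a q α β γ δ) (heunL a q α β γ δ) := by
  obtain ⟨H, hH⟩ := exists_heunL_family ha q α β δ
  exact (hH.isStarContinuation hγ).spec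

/-- For `γ = -n`, the function `heunS` is holomorphic at the origin. -/
lemma isStarContinuation_heunS (ha : a ≠ 0) :
    IsStarContinuation a (sCoeff a q α β δ n) (heunS a q α β (-(n : ℂ)) δ) := by
  have h1 := (isStarContinuation_heunL a
    (q - (-(n : ℂ) - 1) * (eps α β (-(n : ℂ)) δ + a * δ)) (α - -(n : ℂ) + 1)
    (β - -(n : ℂ) + 1) δ ha
    (two_sub_notMem_of_leftHalf (neg_natCast_mem_leftHalf n))).pow_mul (n + 1)
  refine IsStarContinuation.congr_fun (h1.congr_coeff fun m => ?_) (fun z _ => ?_) ha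
  · exact (shiftedSecondCoeff_neg a q α β δ n ha m).symm
  · rw [heunS, show (1 : ℂ) - -(n : ℂ) = ((n + 1 : ℕ) : ℂ) by push_cast; ring,
      Complex.cpow_natCast]

/-- The numerator `(γ + n) * HeunL - K * HeunS` of the regularization vanishes at `γ = -n`; its
derivative there is the logarithmic solution, the logarithm coming from `z ^ (1 - γ)`. -/
theorem tendsto_heunComb (ha : a ≠ 0) :
    IsStarContinuation a (cCoeff a q α β δ n) (starContinuation a (cCoeff a q α β δ n)) ∧
    ∀ z ∈ starDomain a, Tendsto (fun γ : ℂ => heunComb a q α β δ n γ z) (𝓝[≠] (-(n : ℂ)))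
      (𝓝 (heunLLog a q α β δ n (limitConst a q α β δ n) z)) := by
  obtain ⟨H, hH⟩ := exists_res_family a q α β δ n ha
  obtain ⟨G, hG⟩ := exists_second_family ha q α β δ
  have hb : -(n : ℂ) ∈ Metric.ball (-(n : ℂ)) 1 := Metric.mem_ball_self one_pos
  have hmem := neg_natCast_mem_leftHalf n
  have hS := isStarContinuation_heunS a q α β δ n ha
  have hH' := hH.isStarContinuation_deriv Metric.isOpen_ball (fun m γ hγ =>
    (differentiableAt_resCoeff a q α β δ n ha hγ m).differentiableWithinAt) hb
  have hG' := hG.isStarContinuation_deriv isOpen_leftHalf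
    (differentiableOn_secondCoeff ha q α β δ) hmem
  have hC : IsStarContinuation a (cCoeff a q α β δ n) (fun z =>
      deriv (fun γ => H γ z) (-(n : ℂ))
        - K a q α β δ n * (z ^ (n + 1) * deriv (fun γ => G γ z) (-(n : ℂ)))
        - limitConst a q α β δ n * heunS a q α β (-(n : ℂ)) δ z) := by
    refine ((hH'.sub ((hG'.pow_mul (n + 1)).const_mul _)).sub (hS.const_mul _)).congr_coeff
      fun m => ?_
    rw [cCoeff_eq_deriv a q α β δ n ha m]
    congr 3
    by_cases h : n + 1 ≤ m
    · simp only [shiftedSecondCoeff, if_pos h]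
    · simp only [shiftedSecondCoeff, if_neg h, deriv_const]
  refine ⟨hC.spec, fun z hz => ?_⟩
  have hcpow : (z : ℂ) ^ ((1 : ℂ) - -(n : ℂ)) = z ^ (n + 1) := by
    rw [show (1 : ℂ) - -(n : ℂ) = ((n + 1 : ℕ) : ℂ) by push_cast; ring, Complex.cpow_natCast]
  have hGz : z ^ (n + 1) * G (-(n : ℂ)) z = heunS a q α β (-(n : ℂ)) δ z := by
    rw [heunS, hcpow]
    congr 1
    exact ((hG.isStarContinuation hmem).starContinuation_eq ha hz).symm
  have hHz : H (-(n : ℂ)) z = K a q α β δ n * heunS a q α β (-(n : ℂ)) δ z :=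
    (hH.isStarContinuation hb).eqOn ha
      ((hS.const_mul (K a q α β δ n)).congr_coeff (resCoeff_neg a q α β δ n ha)) hz
  have d1 := (hH.analyticAt_left hb hz).differentiableAt.hasDerivAt
  have d2 := (hG.analyticAt_left hmem hz).differentiableAt.hasDerivAt
  have hne : (1 : ℂ) - -(n : ℂ) ≠ 0 := by
    rw [sub_neg_eq_add, add_comm]
    exact Nat.cast_add_one_ne_zero n
  have d3 : HasDerivAt (fun γ : ℂ => z ^ (1 - γ)) (z ^ (n + 1) * Complex.log z * (-1))
      (-(n : ℂ)) := by
    have := ((hasDerivAt_id (-(n : ℂ))).const_sub 1).const_cpow (c := z) (Or.inr hne)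
    refine this.congr_deriv ?_
    rw [← hcpow, id]
  have d4 := d1.sub ((d3.mul d2).const_mul (K a q α β δ n))
  rw [hasDerivAt_iff_tendsto_slope] at d4
  have hlim : heunLLog a q α β δ n (limitConst a q α β δ n) z
      = deriv (fun w => H w z) (-(n : ℂ)) - K a q α β δ n *
        (z ^ (n + 1) * Complex.log z * (-1) * G (-(n : ℂ)) z
          + z ^ (1 - -(n : ℂ)) * deriv (fun w => G w z) (-(n : ℂ))) := by
    rw [heunLLog, hC.starContinuation_eq ha hz, hS.starContinuation_eq ha hz, hcpow, ← hGz,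
      logConst_eq_K]
    ring
  rw [hlim]
  refine d4.congr' ?_
  filter_upwards [self_mem_nhdsWithin, mem_nhdsWithin_of_mem_nhds
    (Metric.ball_mem_nhds (-(n : ℂ)) one_pos), mem_nhdsWithin_of_mem_nhds
    (isOpen_leftHalf.mem_nhds hmem)] with γ h1 h2 h3
  have hγ : γ ≠ -(n : ℂ) := h1
  have hγn : γ + n ≠ 0 := by rwa [← sub_neg_eq_add, sub_ne_zero]
  have hnon : γ ∉ nonposInts := by
    rintro ⟨m, rfl⟩
    by_cases hm : m = n
    · exact hγ (by rw [hm])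
    · exact ne_neg_natCast_of_mem_ball h2 hm rfl
  have e1 : H γ z = (γ + n) * heunL a q α β γ δ z :=
    (hH.isStarContinuation h2).eqOn ha
      (((isStarContinuation_heunL a q α β δ ha hnon).const_mul (γ + n)).congr_coeff
        (resCoeff_eq_mul a q α β δ n ha h2 hγ)) hz
  have e2 : heunS a q α β γ δ z = z ^ (1 - γ) * G γ z := by
    rw [heunS]
    congr 1
    exact (hG.isStarContinuation h3).starContinuation_eq ha hz
  simp only [slope, vsub_eq_sub, smul_eq_mul, Pi.sub_apply, Pi.mul_apply]
  rw [hHz, hcpow, hGz, e1, heunComb, e2, sub_neg_eq_add]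
  field_simp
  ring

end Limit

/-! ### Smoothness of the cut-off -/

/-- The function `t ↦ x ^ (-k) * exp (-1 / x) * h x` with `x = √t` for `t > 0`, and `0` for
`t ≤ 0` (where `√t = 0`, and `expNegInvGlue` vanishes at `0`). -/
def sqrtGlue (k : ℕ) (h : ℝ → ℝ) (t : ℝ) : ℝ :=
  (√t)⁻¹ ^ k * expNegInvGlue (√t) * h (√t)

lemma sqrtGlue_of_nonpos (k : ℕ) (h : ℝ → ℝ) {t : ℝ} (ht : t ≤ 0) : sqrtGlue k h t = 0 := by
  rw [sqrtGlue, Real.sqrt_eq_zero_of_nonpos ht, expNegInvGlue.zero]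
  ring

lemma tendsto_sqrtGlue (k : ℕ) {h : ℝ → ℝ} (hh : Continuous h) :
    Tendsto (sqrtGlue k h) (𝓝 0) (𝓝 0) := by
  have h1 := expNegInvGlue.tendsto_polynomial_inv_mul_zero (Polynomial.X ^ k)
  simp only [Polynomial.eval_pow, Polynomial.eval_X] at h1
  have h2 : Tendsto (fun t : ℝ => √t) (𝓝 0) (𝓝 0) := by
    simpa using Real.continuous_sqrt.tendsto 0
  have h3 := (h1.mul (hh.tendsto 0)).comp h2
  rw [zero_mul] at h3
  exact h3

lemma hasDerivAt_expNegInvGlue {x : ℝ} (hx : 0 < x) :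
    HasDerivAt expNegInvGlue (x⁻¹ ^ 2 * expNegInvGlue x) x := by
  have h1 : HasDerivAt (fun y : ℝ => Real.exp (-y⁻¹)) (Real.exp (-x⁻¹) * -(-(x ^ 2)⁻¹)) x :=
    (hasDerivAt_inv hx.ne').neg.exp
  have h2 : expNegInvGlue =ᶠ[𝓝 x] fun y : ℝ => Real.exp (-y⁻¹) := by
    filter_upwards [lt_mem_nhds hx] with y hy
    rw [expNegInvGlue, if_neg (not_le.2 hy)]
  refine (h1.congr_of_eventuallyEq h2).congr_deriv ?_
  rw [h2.eq_of_nhds, inv_pow]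
  ring

/-- The class of the functions `sqrtGlue k h` is closed under differentiation. -/
lemma hasDerivAt_sqrtGlue (k : ℕ) {h : ℝ → ℝ} (hh : Differentiable ℝ h) (t : ℝ) :
    HasDerivAt (sqrtGlue k h)
      (1 / 2 * sqrtGlue (k + 3) (fun x => -k * x * h x + h x + x ^ 2 * deriv h x) t) t := by
  rcases lt_trichotomy t 0 with ht | rfl | ht
  · rw [sqrtGlue_of_nonpos _ _ ht.le, mul_zero]
    refine (hasDerivAt_const t (0 : ℝ)).congr_of_eventuallyEq ?_
    filter_upwards [gt_mem_nhds ht] with y hy using sqrtGlue_of_nonpos k h hy.le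
  · rw [sqrtGlue_of_nonpos _ _ le_rfl, mul_zero, hasDerivAt_iff_tendsto_slope]
    refine ((tendsto_sqrtGlue (k + 2) hh.continuous).mono_left nhdsWithin_le_nhds).congr' ?_
    filter_upwards [self_mem_nhdsWithin] with t ht
    rw [slope_def_field, sqrtGlue_of_nonpos k h le_rfl, sub_zero, sub_zero]
    rcases le_or_gt t 0 with h0 | h0
    · rw [sqrtGlue_of_nonpos _ _ h0, sqrtGlue_of_nonpos _ _ h0, zero_div]
    · have h1 : (√t)⁻¹ ^ 2 = t⁻¹ := by rw [inv_pow, Real.sq_sqrt h0.le]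
      rw [sqrtGlue, sqrtGlue, pow_add, h1]
      ring
  · have hx : 0 < √t := Real.sqrt_pos.2 ht
    have h1 := Real.hasDerivAt_sqrt ht.ne'
    have h2 := (((hasDerivAt_inv hx.ne').pow k).mul (hasDerivAt_expNegInvGlue hx)).mul
      (hh (√t)).hasDerivAt
    refine (h2.comp t h1).congr_deriv ?_
    rw [sqrtGlue]
    generalize √t = x at hx
    simp only [Pi.mul_apply, Pi.pow_apply]
    rcases k with _ | k
    · simp
      field_simp
    · rw [Nat.add_sub_cancel]
      simp only [inv_pow]
      push_cast
      field_simp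
      ring

lemma contDiff_sqrtGlue (k : ℕ) {h : ℝ → ℝ} (hh : ContDiff ℝ ∞ h) :
    ContDiff ℝ ∞ (sqrtGlue k h) := by
  rw [contDiff_infty]
  intro m
  induction m generalizing k h with
  | zero =>
    exact contDiff_zero.2 (Differentiable.continuous (𝕜 := ℝ) fun t =>
      (hasDerivAt_sqrtGlue k (hh.differentiable (by simp)) t).differentiableAt)
  | succ m ih =>
    have hd : Differentiable ℝ h := hh.differentiable (by simp)
    have hd' : ContDiff ℝ ∞ (deriv h) := (contDiff_infty_iff_deriv.1 hh).2
    push_cast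
    rw [contDiff_succ_iff_deriv]
    refine ⟨fun t => (hasDerivAt_sqrtGlue k hd t).differentiableAt, by simp, ?_⟩
    rw [funext fun t => (hasDerivAt_sqrtGlue k hd t).deriv]
    exact contDiff_const.mul (ih (k + 3) (by fun_prop))

lemma rho_eq (r : ℝ) : rho r = 1 - Real.smoothTransition (2 * r) := by
  rw [rho]
  split_ifs with h1 h2
  · rw [Real.smoothTransition.zero_of_nonpos (by linarith), sub_zero]
  · rw [not_le] at h1
    have h3 : 1 - 2 * r ≠ 0 := by linarith
    have h4 : 2 * r - 1 ≠ 0 := by linarith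
    rw [Real.smoothTransition, expNegInvGlue, expNegInvGlue, if_neg (by linarith),
      if_neg (by linarith)]
    have e1 : 1 / (2 * r) + 1 / (2 * r - 1) = (2 * r)⁻¹ + -(1 - 2 * r)⁻¹ := by
      field_simp
      ring
    have e2 := Real.exp_pos (2 * r)⁻¹
    have e3 := Real.exp_pos (-(1 - 2 * r)⁻¹)
    rw [e1, Real.exp_add, Real.exp_neg (2 * r)⁻¹]
    generalize Real.exp (2 * r)⁻¹ = A at e2
    generalize Real.exp (-(1 - 2 * r)⁻¹) = B at e3
    have e4 : 0 < 1 + A * B := by positivity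
    field_simp
    ring
  · rw [Real.smoothTransition.one_of_one_le (by linarith), sub_self]

lemma rho_eq_zero {r : ℝ} (h : 1 / 2 ≤ r) : rho r = 0 := by
  rw [rho_eq, Real.smoothTransition.one_of_one_le (by linarith), sub_self]

/-- The quotient `(1 - ρ(|w|)) / w`. -/
def cutQuot (w : ℂ) : ℂ := (1 - (rho ‖w‖ : ℂ)) / w

lemma cutQuot_zero : cutQuot 0 = 0 := by simp [cutQuot]

/-- The function `1 - ρ(r)` is flat at `r = 0`. As a function of `r ^ 2` it is therefore smooth,
also after division by `r ^ 2`. -/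
lemma contDiff_cutQuot : ContDiff ℝ ∞ cutQuot := by
  have hne : ∀ x, expNegInvGlue x + expNegInvGlue (1 - x) ≠ 0 := fun x =>
    (Real.smoothTransition.pos_denom x).ne'
  have hh : ContDiff ℝ ∞ fun x => (expNegInvGlue x + expNegInvGlue (1 - x))⁻¹ :=
    (expNegInvGlue.contDiff.add (expNegInvGlue.contDiff.comp
      (contDiff_const.sub contDiff_id))).inv hne
  have e : cutQuot = fun w : ℂ => Complex.conjCLE w * Complex.ofRealCLM
      (4 * sqrtGlue 2 (fun x => (expNegInvGlue x + expNegInvGlue (1 - x))⁻¹) (4 * ‖w‖ ^ 2)) := by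
    funext w
    by_cases hw : w = 0
    · simp [hw, cutQuot_zero]
    have hs : √(4 * ‖w‖ ^ 2) = 2 * ‖w‖ := by
      rw [show 4 * ‖w‖ ^ 2 = (2 * ‖w‖) ^ 2 by ring, Real.sqrt_sq (by positivity)]
    have hw' : (‖w‖ : ℂ) ≠ 0 := by simpa using hw
    rw [cutQuot, rho_eq, sqrtGlue, hs, div_eq_iff hw]
    simp only [Complex.conjCLE_apply, Complex.ofRealCLM_apply, Real.smoothTransition]
    have hc : (starRingEnd ℂ) w * w = (‖w‖ : ℂ) ^ 2 := by
      rw [mul_comm, Complex.mul_conj, Complex.normSq_eq_norm_sq]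
      push_cast
      rfl
    rw [mul_right_comm, hc]
    push_cast
    field_simp
    ring
  rw [e]
  refine Complex.conjCLE.contDiff.mul (Complex.ofRealCLM.contDiff.comp ?_)
  exact contDiff_const.mul ((contDiff_sqrtGlue 2 hh).comp
    (contDiff_const.mul (contDiff_norm_sq ℝ)))

/-! ### The regularized function -/

lemma eq_of_norm_add_lt {γ : ℂ} {m n : ℕ} (hm : ‖γ + m‖ < 1 / 2) (hn : ‖γ + n‖ < 1 / 2) :
    m = n := by
  have h1 : ‖(((m : ℤ) - n : ℤ) : ℂ)‖ < 1 := by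
    have e : (((m : ℤ) - n : ℤ) : ℂ) = (γ + m) - (γ + n) := by push_cast; ring
    rw [e]
    linarith [norm_sub_le (γ + m) (γ + n)]
  rw [Complex.norm_intCast] at h1
  have h2 : |(m : ℤ) - n| < 1 := by exact_mod_cast h1
  have := abs_lt.1 h2
  omega

section Regularization

variable (a q α β δ : ℂ)

lemma heunLReg_of_forall {γ : ℂ} (h : ∀ n : ℕ, 1 / 2 ≤ ‖γ + n‖) (z : ℂ) :
    heunLReg a q α β γ δ z = heunL a q α β γ δ z := by
  rw [heunLReg, dif_neg]
  rintro ⟨n, hn⟩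
  exact absurd hn (not_lt.2 (h n))

lemma heunLReg_of_lt {γ : ℂ} {n : ℕ} (h : ‖γ + n‖ < 1 / 2) (hγ : γ ≠ -(n : ℂ)) (z : ℂ) :
    heunLReg a q α β γ δ z = heunCutComb a q α β δ n γ z := by
  have hex : ∃ n : ℕ, ‖γ + n‖ < 1 / 2 := ⟨n, h⟩
  have hc : hex.choose = n := eq_of_norm_add_lt hex.choose_spec h
  rw [heunLReg, dif_pos hex, hc, if_neg hγ]

lemma heunLReg_neg (n : ℕ) (z : ℂ) : heunLReg a q α β (-(n : ℂ)) δ z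
    = limUnder (𝓝[≠] (-(n : ℂ))) fun γ => heunCutComb a q α β δ n γ z := by
  have h : ‖-(n : ℂ) + n‖ < 1 / 2 := by simp
  have hex : ∃ n' : ℕ, ‖-(n : ℂ) + n'‖ < 1 / 2 := ⟨n, h⟩
  have hc : hex.choose = n := eq_of_norm_add_lt hex.choose_spec h
  rw [heunLReg, dif_pos hex, hc, if_pos rfl]

lemma le_norm_add_of_le_infDist {γ : ℂ} (h : 1 / 2 ≤ Metric.infDist γ nonposInts) (n : ℕ) :
    1 / 2 ≤ ‖γ + n‖ := by
  have hmem : -(n : ℂ) ∈ nonposInts := ⟨n, rfl⟩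
  refine h.trans ((Metric.infDist_le_dist_of_mem hmem).trans_eq ?_)
  rw [dist_eq_norm, sub_neg_eq_add]

lemma notMem_nonposInts_of_forall {γ : ℂ} (h : ∀ n : ℕ, 1 / 2 ≤ ‖γ + n‖) : γ ∉ nonposInts := by
  rintro ⟨n, rfl⟩
  have := h n
  norm_num at this

lemma heunCutComb_eq (n : ℕ) (γ z : ℂ) : heunCutComb a q α β δ n γ z
    = heunComb a q α β δ n γ z
      + K a q α β δ n * cutQuot (γ + n) * heunS a q α β γ δ z := by
  rw [heunCutComb, heunComb, cutQuot]
  ring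

variable {a}

lemma analyticAt_heunL (ha : a ≠ 0) {γ z : ℂ} (hγ : γ ∉ nonposInts) (hz : z ∈ starDomain a) :
    AnalyticAt ℂ (fun γ => heunL a q α β γ δ z) γ := by
  obtain ⟨H, hH⟩ := exists_heunL_family ha q α β δ
  refine (hH.analyticAt_left hγ hz).congr ?_
  filter_upwards [isOpen_compl_nonposInts.mem_nhds hγ] with x hx
  exact ((hH.isStarContinuation hx).starContinuation_eq ha hz).symm

lemma analyticAt_heunS (ha : a ≠ 0) {γ z : ℂ} (hγ : γ ∈ leftHalf) (hz : z ∈ starDomain a) :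
    AnalyticAt ℂ (fun γ => heunS a q α β γ δ z) γ := by
  obtain ⟨G, hG⟩ := exists_second_family ha q α β δ
  have h1 : DifferentiableOn ℂ (fun γ : ℂ => z ^ (1 - γ)) leftHalf := fun γ hγ => by
    have hne : (1 : ℂ) - γ ≠ 0 := by
      intro h
      have h2 : γ = 1 := (sub_eq_zero.1 h).symm
      have h3 : γ.re < 1 := hγ
      rw [h2] at h3
      simp at h3
    exact (DifferentiableAt.const_cpow (by fun_prop) (Or.inr hne)).differentiableWithinAt
  refine ((h1.analyticAt (isOpen_leftHalf.mem_nhds hγ)).mul (hG.analyticAt_left hγ hz)).congr ?_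
  filter_upwards [isOpen_leftHalf.mem_nhds hγ] with x hx
  simp only [Pi.mul_apply, heunS]
  congr 1
  exact ((hG.isStarContinuation hx).starContinuation_eq ha hz).symm

variable {n : ℕ} {z : ℂ}

lemma notMem_nonposInts_of_norm_lt {γ : ℂ} (h : ‖γ + n‖ < 1 / 2) (hγ : γ ≠ -(n : ℂ)) :
    γ ∉ nonposInts := by
  rintro ⟨m, rfl⟩
  exact hγ (by rw [eq_of_norm_add_lt (γ := -(m : ℂ)) (m := m) (by simp) h])

lemma mem_leftHalf_of_norm_le {γ : ℂ} (h : ‖γ + n‖ ≤ 1 / 2) : γ ∈ leftHalf := by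
  have h1 := (Complex.re_le_norm (γ + n)).trans h
  rw [Complex.add_re, Complex.natCast_re] at h1
  have h2 : (0 : ℝ) ≤ n := Nat.cast_nonneg n
  simp only [leftHalf, Set.mem_ofPred_eq]
  linarith

lemma heunLReg_neg_eq (ha : a ≠ 0) (hz : z ∈ starDomain a) :
    heunLReg a q α β (-(n : ℂ)) δ z = heunLLog a q α β δ n (limitConst a q α β δ n) z := by
  rw [heunLReg_neg]
  refine Tendsto.limUnder_eq ?_
  have h1 := (tendsto_heunComb a q α β δ n ha).2 z hz
  have h2 : Tendsto (fun γ : ℂ => K a q α β δ n * cutQuot (γ + n) * heunS a q α β γ δ z)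
      (𝓝[≠] (-(n : ℂ))) (𝓝 0) := by
    have h3 : ContinuousAt
        (fun γ : ℂ => K a q α β δ n * cutQuot (γ + n) * heunS a q α β γ δ z) (-(n : ℂ)) := by
      have h4 := (analyticAt_heunS q α β δ ha (neg_natCast_mem_leftHalf n) hz).continuousAt
      have h5 := contDiff_cutQuot.continuous
      fun_prop
    have h6 := h3.tendsto.mono_left (nhdsWithin_le_nhds (s := {-(n : ℂ)}ᶜ))
    simpa [cutQuot_zero] using h6
  have h7 := h1.add h2
  rw [add_zero] at h7
  exact h7.congr fun γ => (heunCutComb_eq a q α β δ n γ z).symm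

/-- In the disc around `-n` the regularized function is the sum of a holomorphic function (the
removable singularity of `heunComb` being filled in) and a smooth one. -/
lemma contDiffAt_heunLReg_of_lt (ha : a ≠ 0) (hz : z ∈ starDomain a) {γ : ℂ}
    (h : ‖γ + n‖ < 1 / 2) : ContDiffAt ℝ ∞ (fun γ => heunLReg a q α β γ δ z) γ := by
  have hopen : IsOpen {γ : ℂ | ‖γ + n‖ < 1 / 2} := isOpen_lt (by fun_prop) continuous_const
  have han : ∀ x : ℂ, ‖x + n‖ < 1 / 2 → x ≠ -(n : ℂ) →
      AnalyticAt ℂ (fun γ => heunComb a q α β δ n γ z) x := by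
    intro x hx hxn
    have h1 := analyticAt_heunL q α β δ ha (notMem_nonposInts_of_norm_lt hx hxn) hz
    have h2 := analyticAt_heunS q α β δ ha (mem_leftHalf_of_norm_le hx.le) hz
    have h3 : x + n ≠ 0 := by rwa [← sub_neg_eq_add, sub_ne_zero]
    exact h1.sub ((analyticAt_const.div (analyticAt_id.add analyticAt_const) h3).mul h2)
  set F : ℂ → ℂ := Function.update (fun γ => heunComb a q α β δ n γ z) (-(n : ℂ))
    (heunLLog a q α β δ n (limitConst a q α β δ n) z) with hF
  have hFne : ∀ x : ℂ, x ≠ -(n : ℂ) → F =ᶠ[𝓝 x] fun γ => heunComb a q α β δ n γ z := by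
    intro x hx
    filter_upwards [isOpen_ne.mem_nhds hx] with y hy
    rw [hF, Function.update_of_ne hy]
  have hFan : AnalyticAt ℂ F γ := by
    by_cases hγ : γ = -(n : ℂ)
    · subst hγ
      refine Complex.analyticAt_of_differentiable_on_punctured_nhds_of_continuousAt ?_ ?_
      · filter_upwards [self_mem_nhdsWithin, mem_nhdsWithin_of_mem_nhds (hopen.mem_nhds h)]
          with x hx1 hx2
        exact ((han x hx2 hx1).congr (hFne x hx1).symm).differentiableAt
      · exact continuousAt_update_same.2 ((tendsto_heunComb a q α β δ n ha).2 z hz)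
    · exact (han γ h hγ).congr (hFne γ hγ).symm
  have hS := (analyticAt_heunS q α β δ ha (mem_leftHalf_of_norm_le h.le) hz).contDiffAt
    (n := ∞) |>.restrict_scalars ℝ
  have hχ : ContDiffAt ℝ ∞ (fun γ : ℂ => cutQuot (γ + n)) γ :=
    (contDiff_cutQuot.comp (contDiff_id.add contDiff_const)).contDiffAt
  have hsum := ((hFan.contDiffAt (n := ∞)).restrict_scalars ℝ).add
    ((contDiffAt_const (c := K a q α β δ n)).mul hχ |>.mul hS)
  refine hsum.congr_of_eventuallyEq ?_
  filter_upwards [hopen.mem_nhds h] with x hx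
  by_cases hxn : x = -(n : ℂ)
  · rw [hxn, heunLReg_neg_eq q α β δ ha hz, hF, Function.update_self, neg_add_cancel, cutQuot_zero]
    ring
  · rw [heunLReg_of_lt a q α β δ hx hxn, heunCutComb_eq, hF, Function.update_of_ne hxn]

/-- Outside the open discs, including their boundaries, the regularized function locally is
`heunL` minus finitely many cut-off terms. -/
lemma contDiffAt_heunLReg_of_forall (ha : a ≠ 0) (hz : z ∈ starDomain a) {γ : ℂ}
    (h : ∀ n : ℕ, 1 / 2 ≤ ‖γ + n‖) : ContDiffAt ℝ ∞ (fun γ => heunLReg a q α β γ δ z) γ := by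
  have hγ := notMem_nonposInts_of_forall h
  obtain ⟨N, hN⟩ := exists_nat_gt (‖γ‖ + 2)
  have hterm : ∀ n : ℕ, ContDiffAt ℝ ∞ (fun γ : ℂ =>
      K a q α β δ n / (γ + n) * (rho ‖γ + n‖ : ℂ) * heunS a q α β γ δ z) γ := by
    intro n
    rcases (h n).eq_or_lt with h1 | h1
    · have hS := (analyticAt_heunS q α β δ ha (mem_leftHalf_of_norm_le h1.symm.le) hz).contDiffAt
        (n := ∞) |>.restrict_scalars ℝ
      have hne : γ + n ≠ 0 := by
        rw [← norm_pos_iff, ← h1]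
        norm_num
      have hid : ContDiffAt ℝ ∞ (fun γ : ℂ => γ + n) γ := contDiffAt_id.add contDiffAt_const
      have hρ : ContDiffAt ℝ ∞ (fun γ : ℂ => (rho ‖γ + n‖ : ℂ)) γ := by
        simp only [rho_eq]
        exact Complex.ofRealCLM.contDiff.contDiffAt.comp γ (contDiffAt_const.sub
          (Real.smoothTransition.contDiff.contDiffAt.comp γ
            (contDiffAt_const.mul (hid.norm ℝ hne))))
      simp only [div_eq_mul_inv]
      exact ((contDiffAt_const.mul (hid.inv hne)).mul hρ).mul hS
    · refine (contDiffAt_const (c := (0 : ℂ))).congr_of_eventuallyEq ?_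
      filter_upwards [(isOpen_lt continuous_const
        (show Continuous fun γ : ℂ => ‖γ + n‖ by fun_prop)).mem_nhds h1] with x hx
      rw [rho_eq_zero (le_of_lt hx)]
      simp
  have hsum := (((analyticAt_heunL q α β δ ha hγ hz).contDiffAt
    (n := ∞)).restrict_scalars ℝ).sub (ContDiffAt.sum (s := Finset.range N) fun n _ => hterm n)
  refine hsum.congr_of_eventuallyEq ?_
  filter_upwards [isOpen_compl_nonposInts.mem_nhds hγ, Metric.ball_mem_nhds γ one_pos] with x hx hxb
  have hxN : ∀ n : ℕ, ‖x + n‖ < 1 / 2 → n ∈ Finset.range N := by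
    intro n hn
    rw [Metric.mem_ball, dist_eq_norm] at hxb
    have h1 : (n : ℝ) = ‖(x + n) - (x - γ) - γ‖ := by
      rw [show (x + n) - (x - γ) - γ = (n : ℂ) by ring, Complex.norm_natCast]
    have h2 := norm_sub_le ((x + n) - (x - γ)) γ
    have h3 := norm_sub_le (x + n) (x - γ)
    rw [Finset.mem_range]
    exact_mod_cast (show (n : ℝ) < N by linarith)
  by_cases hex : ∃ n : ℕ, ‖x + n‖ < 1 / 2
  · obtain ⟨n, hn⟩ := hex
    rw [heunLReg_of_lt a q α β δ hn (ne_neg_natCast hx n), heunCutComb]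
    congr 1
    refine (Finset.sum_eq_single_of_mem (f := fun n : ℕ => K a q α β δ n / (x + n)
      * (rho ‖x + n‖ : ℂ) * heunS a q α β x δ z) n (hxN n hn) fun m _ hm => ?_).symm
    have h4 : 1 / 2 ≤ ‖x + m‖ := by
      by_contra! h5
      exact hm (eq_of_norm_add_lt h5 hn)
    rw [rho_eq_zero h4]
    simp
  · push Not at hex
    rw [heunLReg_of_forall a q α β δ hex]
    have h6 : ∑ n ∈ Finset.range N, K a q α β δ n / (x + n) * (rho ‖x + n‖ : ℂ)
        * heunS a q α β x δ z = 0 :=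
      Finset.sum_eq_zero fun n _ => by rw [rho_eq_zero (hex n)]; simp
    rw [h6, sub_zero]

lemma contDiff_heunLReg (ha : a ≠ 0) (hz : z ∈ starDomain a) :
    ContDiff ℝ ∞ (fun γ => heunLReg a q α β γ δ z) := by
  refine contDiff_iff_contDiffAt.2 fun γ => ?_
  by_cases h : ∃ n : ℕ, ‖γ + n‖ < 1 / 2
  · obtain ⟨n, hn⟩ := h
    exact contDiffAt_heunLReg_of_lt q α β δ ha hz hn
  · push Not at h
    exact contDiffAt_heunLReg_of_forall q α β δ ha hz h

/-! ### Linear independence -/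

lemma heunLLog_zero (ha : a ≠ 0) (A : ℂ) : heunLLog a q α β δ n A 0 = 1 := by
  rw [heunLLog, (tendsto_heunComb a q α β δ n ha).1.apply_zero,
    (isStarContinuation_heunS a q α β δ n ha).spec.apply_zero,
    sCoeff_of_le _ _ _ _ _ _ (Nat.zero_le n), cCoeff_of_le _ _ _ _ _ _ (Nat.zero_le n), heunCoeff]
  ring

lemma heunS_zero (ha : a ≠ 0) : heunS a q α β (-(n : ℂ)) δ 0 = 0 := by
  rw [(isStarContinuation_heunS a q α β δ n ha).apply_zero,
    sCoeff_of_le _ _ _ _ _ _ (Nat.zero_le n)]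

lemma zero_mem_cutDomain (ha : a ≠ 0) : (0 : ℂ) ∈ cutDomain a :=
  ⟨zero_mem_starDomain ha, fun t ht h => ht.ne (by exact_mod_cast h.symm)⟩

lemma exists_heunS_ne_zero (ha : a ≠ 0) :
    ∃ z ∈ cutDomain a, heunS a q α β (-(n : ℂ)) δ z ≠ 0 := by
  have hf := isStarContinuation_heunL a
    (q - (-(n : ℂ) - 1) * (eps α β (-(n : ℂ)) δ + a * δ)) (α - -(n : ℂ) + 1)
    (β - -(n : ℂ) + 1) δ ha (two_sub_notMem_of_leftHalf (neg_natCast_mem_leftHalf n))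
  have h0 := zero_mem_starDomain ha
  have hne := (hf.analyticOnNhd 0 h0).continuousAt.eventually_ne (y := 0) (by
    rw [hf.apply_zero, heunCoeff]
    exact one_ne_zero)
  have h1 := hne.and ((isOpen_starDomain a).mem_nhds h0)
  have h2 : Tendsto (fun t : ℝ => (t : ℂ)) (𝓝[>] 0) (𝓝 0) := by
    have := (Complex.continuous_ofReal.tendsto 0).mono_left (nhdsWithin_le_nhds (s := Set.Ioi 0))
    simpa using this
  obtain ⟨t, ⟨ht1, ht2⟩, ht⟩ := ((h2.eventually h1).and self_mem_nhdsWithin).exists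
  have ht0 : (0 : ℝ) < t := ht
  refine ⟨t, ⟨ht2, fun s hs h => ?_⟩, ?_⟩
  · have : t = s := by exact_mod_cast h
    linarith
  · rw [heunS]
    refine mul_ne_zero ?_ ht1
    rw [Complex.cpow_ne_zero_iff]
    left
    exact_mod_cast ht0.ne'

lemma linearIndependent_heunLLog_heunS (ha : a ≠ 0) (A : ℂ) : LinearIndependent ℂ
    ![fun z : cutDomain a => heunLLog a q α β δ n A z,
      fun z : cutDomain a => heunS a q α β (-(n : ℂ)) δ z] := by
  rw [LinearIndependent.pair_iff]
  intro s t h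
  have h0 := congrFun h ⟨0, zero_mem_cutDomain ha⟩
  simp only [Pi.add_apply, Pi.smul_apply, smul_eq_mul, heunLLog_zero q α β δ ha,
    heunS_zero q α β δ ha, Pi.zero_apply, mul_one, mul_zero, add_zero] at h0
  refine ⟨h0, ?_⟩
  obtain ⟨z, hz, hne⟩ := exists_heunS_ne_zero q α β δ (n := n) ha
  have h1 := congrFun h ⟨z, hz⟩
  simp only [Pi.add_apply, Pi.smul_apply, smul_eq_mul, h0, Pi.zero_apply, zero_mul, zero_add] at h1
  exact (mul_eq_zero.1 h1).resolve_right hne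

end Regularization

end HeunReg

end

theorem mainTheorem1 (a q α β δ : ℂ) (ha0 : a ≠ 0) (ha1 : a ≠ 1) :
    -- `HeunL` is well defined: its series continues to the star domain and solves Heun's equation
    (∀ γ : ℂ, γ ∉ HeunReg.nonposInts →
      HeunReg.IsStarContinuation a (HeunReg.heunCoeff a q α β γ δ)
        (fun z => HeunReg.heunL a q α β γ δ z) ∧
      HeunReg.IsHeunSolutionOn a q α β γ δ (HeunReg.starDomain a \ {0})
        (fun z => HeunReg.heunL a q α β γ δ z)) ∧
    -- the two defining formulas of the regularized function
    (∀ γ : ℂ, 1 / 2 ≤ Metric.infDist γ HeunReg.nonposInts → ∀ z ∈ HeunReg.starDomain a,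
      HeunReg.heunLReg a q α β γ δ z = HeunReg.heunL a q α β γ δ z) ∧
    (∀ n : ℕ, ∀ γ : ℂ, ‖γ + n‖ < 1 / 2 → γ ≠ -(n : ℂ) → ∀ z ∈ HeunReg.cutDomain a,
      HeunReg.heunLReg a q α β γ δ z =
        HeunReg.heunL a q α β γ δ z
          - HeunReg.K a q α β δ n / (γ + n) * (HeunReg.rho ‖γ + n‖ : ℂ)
            * HeunReg.heunS a q α β γ δ z) ∧
    -- analytic in `γ` outside the vicinities
    (∀ z ∈ HeunReg.starDomain a,
      AnalyticOn ℂ (fun γ : ℂ => HeunReg.heunLReg a q α β γ δ z)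
        {γ : ℂ | 1 / 2 ≤ Metric.infDist γ HeunReg.nonposInts}) ∧
    -- smooth in `γ`, in the vicinities and across their boundaries
    (∀ z ∈ HeunReg.cutDomain a,
      ContDiff ℝ ∞ (fun γ : ℂ => HeunReg.heunLReg a q α β γ δ z)) ∧
    -- the limit as `γ → -n`
    (∀ n : ℕ,
      HeunReg.IsStarContinuation a (HeunReg.cCoeff a q α β δ n)
        (HeunReg.starContinuation a (HeunReg.cCoeff a q α β δ n)) ∧
      HeunReg.IsStarContinuation a (HeunReg.sCoeff a q α β δ n)
        (HeunReg.starContinuation a (HeunReg.sCoeff a q α β δ n)) ∧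
      HeunReg.IsHeunSolutionOn a q α β (-(n : ℂ)) δ (HeunReg.cutDomain a \ {0})
        (fun z => HeunReg.heunS a q α β (-(n : ℂ)) δ z) ∧
      ∃ A : ℂ,
        (∀ z ∈ HeunReg.cutDomain a,
          Filter.Tendsto (fun γ : ℂ => HeunReg.heunComb a q α β δ n γ z)
            (𝓝[≠] (-(n : ℂ))) (𝓝 (HeunReg.heunLLog a q α β δ n A z)) ∧
          HeunReg.heunLReg a q α β (-(n : ℂ)) δ z = HeunReg.heunLLog a q α β δ n A z) ∧
        HeunReg.IsHeunSolutionOn a q α β (-(n : ℂ)) δ (HeunReg.cutDomain a \ {0})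
          (fun z => HeunReg.heunLLog a q α β δ n A z) ∧
        LinearIndependent ℂ
          ![fun z : HeunReg.cutDomain a => HeunReg.heunLLog a q α β δ n A z,
            fun z : HeunReg.cutDomain a => HeunReg.heunS a q α β (-(n : ℂ)) δ z]) := by
  refine ⟨fun γ hγ => ?_, fun γ hγ z _ => ?_, fun n γ hn hγ z _ => ?_, fun z hz γ hγ => ?_,
    fun z hz => HeunReg.contDiff_heunLReg q α β δ ha0 hz.1, fun n => ?_⟩
  · have h := HeunReg.isStarContinuation_heunL a q α β δ ha0 hγ
    exact ⟨h, h.isHeunSolutionOn ha0 (HeunReg.isHeunSeq_heunCoeff ha0 q α β δ hγ)⟩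
  · exact HeunReg.heunLReg_of_forall a q α β δ (HeunReg.le_norm_add_of_le_infDist hγ) z
  · exact HeunReg.heunLReg_of_lt a q α β δ hn hγ z
  · have hfar := HeunReg.le_norm_add_of_le_infDist hγ
    refine (HeunReg.analyticAt_heunL q α β δ ha0 (HeunReg.notMem_nonposInts_of_forall hfar)
      hz).analyticWithinAt.congr (fun x hx => ?_) ?_
    · exact HeunReg.heunLReg_of_forall a q α β δ (HeunReg.le_norm_add_of_le_infDist hx) z
    · exact HeunReg.heunLReg_of_forall a q α β δ hfar z
  · have hS := HeunReg.isStarContinuation_heunS a q α β δ n ha0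
    have hs := HeunReg.isHeunSeq_sCoeff a q α β δ n ha0
    obtain ⟨hC, hlim⟩ := HeunReg.tendsto_heunComb a q α β δ n ha0
    refine ⟨hC, hS.spec, (hS.isHeunSolutionOn ha0 hs).mono
      (Set.sdiff_subset_sdiff_left fun z hz => hz.1), HeunReg.limitConst a q α β δ n,
      fun z hz => ⟨hlim z hz.1, HeunReg.heunLReg_neg_eq q α β δ ha0 hz.1⟩, ?_,
      HeunReg.linearIndependent_heunLLog_heunS q α β δ ha0 _⟩
    exact HeunReg.isHeunSolutionOn_log ha0 hC hS.spec
      (HeunReg.isLogHeunSeq_cCoeff a q α β δ n ha0) hs _
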